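/- Let $(M,g)$ and $(N,h)$ be smooth Riemannian manifolds (Hausdorff, second countable, without boundary) of arbitrary finite dimensions. Write $\mathrm{vol}_g$ for the Riemannian volume, $E_2(\varphi)=\frac12\int_M|d\varphi|^2\,\mathrm{vol}_g$ for the Dirichlet energy of a map $\varphi:M\to N$, and, for $(0,2)$ tensor fields $\alpha,\beta$ on $M$, $\langle\alpha,\beta\rangle_{L^2}=\int_M\sum_{i,j}\alpha(e_i,e_j)\beta(e_i,e_j)\,\mathrm{vol}_g$ with $e_1,\dots,e_m$ a local $g$-orthonormal frame. Let $\mathrm{SDiff}(M,g)$ be the group of smooth volume preserving diffeomorphisms of $M$ of compact support, where the support of $\psi$ is the closure of $\{x:\psi(x)\ne x\}$. A smooth curve, or a smooth two-parameter family, in $\mathrm{SDiff}(M,g)$ is one that is jointly smooth in the parameters and the point of $M$ and that, locally in the parameters, is supported in a fixed compact set. Let $\Gamma_0(TM)$ be the space of smooth divergenceless vector fields of compact support on $M$. A smooth map $\varphi:M\to N$ is restricted harmonic if $E_2(\varphi)<\infty$ and $\frac{d}{dt}\big|_{t=0}E_2(\varphi\circ\psi_t)=0$ for every smooth curve $\psi_t$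 in $\mathrm{SDiff}(M,g)$ with $\psi_0=\mathrm{id}_M$. **Theorem.** Let $\varphi:(M,g)\to(N,h)$ be restricted harmonic and let $X,Y\in\Gamma_0(TM)$. Then $\langle\mathcal L_X\varphi^*h,\mathcal L_Yg\rangle_{L^2}$ is an absolutely convergent integral, and the Hessian of $E_2$ at $\varphi$ is $$\mathsf{Hess}(X,Y)=\tfrac12\big\langle \mathcal L_X\varphi^*h,\ \mathcal L_Y g\big\rangle_{L^2},$$ that is, for every smooth two-parameter family $\psi_{s,t}$, $(s,t)\in\mathbb R^2$, in $\mathrm{SDiff}(M,g)$ with $\psi_{0,0}=\mathrm{id}_M$, $\partial_s\psi_{s,t}|_{s=t=0}=X$ and $\partial_t\psi_{s,t}|_{s=t=0}=Y$, the derivative $$\frac{\partial^2E_2(\varphi\circ\psi_{s,t})}{\partial s\,\partial t}\bigg|_{s=t=0}$$ exists and equals $\tfrac12\langle \mathcal L_X\varphi^*h,\mathcal L_Y g\rangle_{L^2}$. Here $\mathcal L$ denotes the Lie derivative. -/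

import Mathlib

open Bundle Set Filter MeasureTheory
open scoped Manifold ContDiff Topology

noncomputable section

namespace RestrictedHarmonic

/-- The model space `ℝᵐ` of an `m`-dimensional manifold. -/
abbrev Model (m : ℕ) : Type := EuclideanSpace ℝ (Fin m)

/-- The `i`-th standard basis vector of `ℝᵐ`. -/
abbrev stdVec {m : ℕ} (i : Fin m) : Model m := EuclideanSpace.single i (1 : ℝ)

section Definitions

variable {m n : ℕ}
  {M : Type*} [TopologicalSpace M] [ChartedSpace (Model m) M] [IsManifold (𝓡 m) ∞ M]
  {N : Type*} [TopologicalSpace N] [ChartedSpace (Model n) N] [IsManifold (𝓡 n) ∞ N]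

/-- Smooth Riemannian metrics on an `m`-dimensional manifold. -/
abbrev Metric (m : ℕ) (M : Type*) [TopologicalSpace M] [ChartedSpace (Model m) M]
    [IsManifold (𝓡 m) ∞ M] :=
  ContMDiffRiemannianMetric (𝓡 m) ∞ (Model m) (fun x : M => TangentSpace (𝓡 m) x)

/-- Vector fields (not assumed smooth). -/
abbrev VField (m : ℕ) (M : Type*) [TopologicalSpace M] [ChartedSpace (Model m) M] :=
  (x : M) → TangentSpace (𝓡 m) x

/-- `(0,2)` tensor fields (not assumed smooth). -/
abbrev TwoTensor (m : ℕ) (M : Type*) [TopologicalSpace M] [ChartedSpace (Model m) M] :=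
  (x : M) → TangentSpace (𝓡 m) x → TangentSpace (𝓡 m) x → ℝ

/-- A Riemannian metric, regarded as a `(0,2)` tensor field. -/
def Metric.tensor (g : Metric m M) : TwoTensor m M := fun x u v => g.inner x u v

/-- The pullback `φ^* h` of the metric `h`: `(φ^* h)(u, v) = h(dφ u, dφ v)`. -/
def pullbackMetric (φ : M → N) (h : Metric n N) : TwoTensor m M := fun x u v =>
  h.inner (φ x) (mfderiv (𝓡 m) (𝓡 n) φ x u) (mfderiv (𝓡 m) (𝓡 n) φ x v)

/-! ### Coordinate expressions, in the preferred chart around a point `c` -/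

/-- The coordinate vector field in direction `u`, in the chart around `c`, at the point with
coordinates `y`; for `u = stdVec i` this is `∂ᵢ`. -/
def coordVec (c : M) (y u : Model m) : TangentSpace (𝓡 m) ((extChartAt (𝓡 m) c).symm y) :=
  mfderiv 𝓘(ℝ, Model m) (𝓡 m) (extChartAt (𝓡 m) c).symm y u

/-- The coordinate expression of a `(0,2)` tensor field in the chart around `c`. -/
def coordTensor (α : TwoTensor m M) (c : M) (y u v : Model m) : ℝ :=
  α ((extChartAt (𝓡 m) c).symm y) (coordVec c y u) (coordVec c y v)

/-- The coordinate expression of a vector field in the chart around `c`. -/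
def coordField (X : VField m M) (c : M) (y : Model m) : Model m :=
  VectorField.mpullback 𝓘(ℝ, Model m) (𝓡 m) (extChartAt (𝓡 m) c).symm X y

/-- The density `√ det (gᵢⱼ)` in the chart around `c`. -/
def coordDensity (g : Metric m M) (c : M) (y : Model m) : ℝ :=
  Real.sqrt (Matrix.of fun i j : Fin m => coordTensor g.tensor c y (stdVec i) (stdVec j)).det

/-! ### Riemannian volume -/

section Volume

variable [MeasurableSpace M] [BorelSpace M]

/-- The Riemannian volume of the domain of the chart around `c`: the measure
`√ det (gᵢⱼ) dy` on the coordinate domain, transported to `M` (and zero off the chart domain). -/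
def chartVolume (g : Metric m M) (c : M) : Measure M :=
  Measure.map (extChartAt (𝓡 m) c).symm
    ((volume.restrict (extChartAt (𝓡 m) c).target).withDensity
      fun y => ENNReal.ofReal (coordDensity g c y))

/-- The Riemannian volume measure `vol_g`. The chart volumes agree on the overlaps of the charts,
and `vol_g` is the measure glued from them, that is, their least upper bound. -/
def riemannianVolume (g : Metric m M) : Measure M := ⨆ c : M, chartVolume g c

end Volume

/-! ### Tensor algebra and tensor calculus -/

/-- The matrix of a bilinear form on `T_x M` in a fixed basis. -/
def tensorMatrix (α : TwoTensor m M) (x : M) : Matrix (Fin m) (Fin m) ℝ :=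
  Matrix.of fun i j : Fin m => α x (stdVec i : Model m) (stdVec j : Model m)

/-- The trace `g^{ij} αᵢⱼ = ∑ᵢ α(eᵢ, eᵢ)` (`eᵢ` a `g`-orthonormal frame). -/
def metricTrace (g : Metric m M) (α : TwoTensor m M) (x : M) : ℝ :=
  ((tensorMatrix g.tensor x)⁻¹ * tensorMatrix α x).trace

/-- The pointwise inner product of `(0,2)` tensors,
`⟨α, β⟩_g = g^{ik} g^{jl} αᵢⱼ βₖₗ = ∑ᵢⱼ α(eᵢ, eⱼ) β(eᵢ, eⱼ)` (`eᵢ` a `g`-orthonormal frame). -/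
def tensorInner (g : Metric m M) (α β : TwoTensor m M) (x : M) : ℝ :=
  ((tensorMatrix g.tensor x)⁻¹ * tensorMatrix α x * (tensorMatrix g.tensor x)⁻¹ *
    (tensorMatrix β x).transpose).trace

/-- The Lie derivative of a `(0,2)` tensor field. In coordinates,
`(L_X α)(u, v) = Xᵏ (∂ₖ α)(u, v) + α(DX u, v) + α(u, DX v)`. -/
def lieDerivative (X : VField m M) (α : TwoTensor m M) : TwoTensor m M := fun x u v =>
  let y : Model m := extChartAt (𝓡 m) x x
  let u' : Model m := mfderiv (𝓡 m) 𝓘(ℝ, Model m) (extChartAt (𝓡 m) x) x u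
  let v' : Model m := mfderiv (𝓡 m) 𝓘(ℝ, Model m) (extChartAt (𝓡 m) x) x v
  fderiv ℝ (fun z : Model m => coordTensor α x z u' v') y (coordField X x y)
    + coordTensor α x y (fderiv ℝ (coordField X x) y u') v'
    + coordTensor α x y u' (fderiv ℝ (coordField X x) y v')

/-- The divergence of a vector field, `div X = (1/ρ) ∑ᵢ ∂ᵢ (ρ Xⁱ)` with `ρ = √ det (gᵢⱼ)`. -/
def divergence (g : Metric m M) (X : VField m M) (x : M) : ℝ :=
  let y : Model m := extChartAt (𝓡 m) x x
  (coordDensity g x y)⁻¹ *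
    ∑ i : Fin m, fderiv ℝ (fun z : Model m => coordDensity g x z * coordField X x z i) y (stdVec i)

/-- `Γ₀(TM)`: smooth divergenceless vector fields of compact support. -/
structure IsDivFreeCompactField (g : Metric m M) (X : VField m M) : Prop where
  smooth : ContMDiff (𝓡 m) (𝓡 m).tangent ∞ (fun x => (⟨x, X x⟩ : TangentBundle (𝓡 m) M))
  compactSupport : IsCompact (closure {x : M | X x ≠ 0})
  divFree : ∀ x, divergence g X x = 0

section Energy

variable [MeasurableSpace M] [BorelSpace M]

/-- The `L²` inner product of `(0,2)` tensor fields. -/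
def tensorL2Inner (g : Metric m M) (α β : TwoTensor m M) : ℝ :=
  ∫ x, tensorInner g α β x ∂(riemannianVolume g)

/-- `|dφ|² = ∑ᵢ h(dφ eᵢ, dφ eᵢ)`, the `g`-trace of `φ^* h`. -/
def normSqDifferential (g : Metric m M) (h : Metric n N) (φ : M → N) (x : M) : ℝ :=
  metricTrace g (pullbackMetric φ h) x

/-- The map `φ` has finite Dirichlet energy. -/
def HasFiniteEnergy (g : Metric m M) (h : Metric n N) (φ : M → N) : Prop :=
  Integrable (normSqDifferential g h φ) (riemannianVolume g)

/-- The Dirichlet energy `E₂(φ) = ½ ∫_M |dφ|² vol_g`. -/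
def dirichletEnergy (g : Metric m M) (h : Metric n N) (φ : M → N) : ℝ :=
  (1 / 2 : ℝ) * ∫ x, normSqDifferential g h φ x ∂(riemannianVolume g)

/-! ### Volume preserving diffeomorphisms and their variations -/

/-- `SDiff(M, g)`: smooth diffeomorphisms of compact support that preserve `vol_g`. -/
def SDiff (g : Metric m M) : Set (M ≃ₘ^∞⟮𝓡 m, 𝓡 m⟯ M) :=
  {ψ | MeasurePreserving ψ (riemannianVolume g) (riemannianVolume g) ∧
    IsCompact (closure {x : M | ψ x ≠ x})}

/-- A smooth family in `SDiff(M, g)`, with parameters in the normed space `P`: it is jointly smooth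
in the parameter and the point, and locally in the parameter it is supported in a fixed compact
set. For `P = ℝ` these are the smooth curves in `SDiff(M, g)`. -/
structure IsSmoothFamily {P : Type*} [NormedAddCommGroup P] [NormedSpace ℝ P]
    (g : Metric m M) (ψ : P → (M ≃ₘ^∞⟮𝓡 m, 𝓡 m⟯ M)) : Prop where
  mem : ∀ p, ψ p ∈ SDiff g
  smooth : ContMDiff (𝓘(ℝ, P).prod (𝓡 m)) (𝓡 m) ∞ (fun q : P × M => ψ q.1 q.2)
  compactSupport : ∀ p₀ : P, ∃ K : Set M, IsCompact K ∧ ∀ᶠ p in 𝓝 p₀, ∀ x, x ∉ K → ψ p x = x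

/-- `φ` is restricted harmonic: it is smooth, has finite energy, and `E₂(φ ∘ ψ_t)` is critical at
`t = 0` for every smooth curve `ψ_t` in `SDiff(M, g)` through the identity. -/
structure IsRestrictedHarmonic (g : Metric m M) (h : Metric n N) (φ : M → N) : Prop where
  smooth : ContMDiff (𝓡 m) (𝓡 n) ∞ φ
  finiteEnergy : HasFiniteEnergy g h φ
  critical : ∀ ψ : ℝ → (M ≃ₘ^∞⟮𝓡 m, 𝓡 m⟯ M), IsSmoothFamily g ψ → (∀ x, ψ 0 x = x) →
    HasDerivAt (fun t => dirichletEnergy g h (φ ∘ ψ t)) 0 0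

/-- `ψ_{s,t}` is a smooth two-parameter variation of `id_M` in `SDiff(M, g)` tangent to `X, Y`:
`ψ_{0,0} = id`, `∂_s ψ_{s,t} = X` and `∂_t ψ_{s,t} = Y` at `s = t = 0`. (The parameter plane is
connected, so all `ψ_{s,t}` lie in the identity component of `SDiff(M, g)`.) The two tangency
conditions are equalities in the tangent bundle. -/
structure IsVariationTangentTo (g : Metric m M) (X Y : VField m M)
    (ψ : ℝ × ℝ → (M ≃ₘ^∞⟮𝓡 m, 𝓡 m⟯ M)) : Prop where
  family : IsSmoothFamily g ψ
  base : ∀ x, ψ (0, 0) x = x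
  tangent_left : ∀ x, (⟨ψ (0, 0) x,
    mfderiv 𝓘(ℝ, ℝ) (𝓡 m) (fun s : ℝ => ψ (s, 0) x) 0 (1 : ℝ)⟩ : TangentBundle (𝓡 m) M) = ⟨x, X x⟩
  tangent_right : ∀ x, (⟨ψ (0, 0) x,
    mfderiv 𝓘(ℝ, ℝ) (𝓡 m) (fun t : ℝ => ψ (0, t) x) 0 (1 : ℝ)⟩ : TangentBundle (𝓡 m) M) = ⟨x, Y x⟩

/-- `∂²F/∂s∂t = c` at `s = t = 0`: for all `s` near `0` the derivative `D s` of `t ↦ F (s, t)` at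
`t = 0` exists, and `D` has derivative `c` at `s = 0`. -/
def HasMixedDerivAtZero (F : ℝ × ℝ → ℝ) (c : ℝ) : Prop :=
  ∃ D : ℝ → ℝ, (∀ᶠ s in 𝓝 (0 : ℝ), HasDerivAt (fun t => F (s, t)) (D s) 0) ∧ HasDerivAt D c 0

/-- `B` is the hessian of `E₂` at `φ`: for all `X, Y ∈ Γ₀(TM)`, and for every smooth two-parameter
variation `ψ_{s,t}` of the identity in `SDiff(M, g)` tangent to `X, Y`, the mixed derivative of
`E₂(φ ∘ ψ_{s,t})` at `s = t = 0` exists and is `B X Y`. -/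
def IsHessian (g : Metric m M) (h : Metric n N) (φ : M → N)
    (B : VField m M → VField m M → ℝ) : Prop :=
  ∀ X Y : VField m M, IsDivFreeCompactField g X → IsDivFreeCompactField g Y →
    ∀ ψ : ℝ × ℝ → (M ≃ₘ^∞⟮𝓡 m, 𝓡 m⟯ M), IsVariationTangentTo g X Y ψ →
      HasMixedDerivAtZero (fun p => dirichletEnergy g h (φ ∘ ψ p)) (B X Y)

end Energy

end Definitions

end RestrictedHarmonic

end

noncomputable section

set_option linter.unusedSectionVars false

namespace RestrictedHarmonic

/-! ### Smoothness of metric expressions, and matrix algebra of Gram matrices. -/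

section Smoothness

variable {m n : ℕ}
  {M : Type*} [TopologicalSpace M] [ChartedSpace (Model m) M] [IsManifold (𝓡 m) ∞ M]
  {N : Type*} [TopologicalSpace N] [ChartedSpace (Model n) N] [IsManifold (𝓡 n) ∞ N]

/-! The idea is to compare the energy of `φ ∘ ψ_{s,t}` with that of `φ ∘ η_{s,t}`, where `η_{s,t} =
ψ_{s,t} ∘ ψ_{0,t}⁻¹`. For each fixed `t` the curve `s ↦ η_{s,t}` lies in the group and passes
through the identity at `s = 0`, so restricted harmonicity gives `∂_s E₂(φ ∘ η_{s,t}) = 0` at `s =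
0` for every `t`. Hence its mixed derivative vanishes as well.

Since `ψ_{0,t}` preserves volume, substituting it in the integral turns `2 E₂(φ ∘ η_{s,t})` into the
integral of the trace of `(φ ∘ ψ_{s,t})^* h` with respect to the moving metric `ψ_{0,t}^* g`
(`dirichletEnergy_comp_symm_eq`, `integral_paramDeriv_movingDensityFamily`). With `A` the matrix of
`(φ ∘ ψ_{s,t})^* h` and `G` that of `ψ_{0,t}^* g`, the two densities are `tr (G(0)⁻¹ A(s,t))` and
`tr (G(t)⁻¹ A(s,t))`. In the difference of their mixed derivatives the second derivatives of `A`
cancel, leaving `-tr ((G⁻¹)' ∂_s A) = tr (G⁻¹ G' G⁻¹ ∂_s A)`. As `∂_s A` represents `L_X φ^* h` and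
`G'` represents `L_Y g`, this is the pointwise inner product (`mixed_paramDeriv_density_sub`). No
integration by parts is needed.

Three supports carry this: the Lie derivative is the derivative of pullbacks along any family with
the right velocity (`hasDerivAt_pullbackMetric_family`); the volume is locally finite, so the
integrals may be differentiated twice (`IsCompactVariation.hasDerivAt_integral`); and the pointwise
identity, applied to a local family in a chart, shows the integrand to be continuous
(`continuous_tensorInner_lieDerivative`). -/

theorem contMDiffAt_mfderiv_apply {V : Type*} [NormedAddCommGroup V] [NormedSpace ℝ V]
    {w : V → N} {v₀ : V} (hw : ContMDiffAt 𝓘(ℝ, V) (𝓡 n) ∞ w v₀) (ξ : V) :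
    ContMDiffAt 𝓘(ℝ, V) (𝓡 n).tangent ∞
      (fun v => (⟨w v, mfderiv 𝓘(ℝ, V) (𝓡 n) w v ξ⟩ : TangentBundle (𝓡 n) N)) v₀ := by
  have hξ : ContMDiffAt 𝓘(ℝ, V) 𝓘(ℝ, V).tangent ∞
      (fun v => (⟨v, ξ⟩ : TangentBundle 𝓘(ℝ, V) V)) v₀ :=
    (contMDiffAt_vectorSpace_iff_contDiffAt (V := fun v => (ξ : TangentSpace 𝓘(ℝ, V) v))).2
      contDiffAt_const
  exact ContMDiffAt.clm_apply_of_inCoordinates (hw.mfderiv_const (m := ∞) (by simp)) hξ hw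

theorem contDiffAt_metric_mfderiv {V : Type*} [NormedAddCommGroup V] [NormedSpace ℝ V]
    (h : Metric n N) {w : V → N} {v₀ : V} (hw : ContMDiffAt 𝓘(ℝ, V) (𝓡 n) ∞ w v₀) (ξ ζ : V) :
    ContDiffAt ℝ ∞ (fun v => h.inner (w v) (mfderiv 𝓘(ℝ, V) (𝓡 n) w v ξ)
      (mfderiv 𝓘(ℝ, V) (𝓡 n) w v ζ)) v₀ := by
  have h1 := (h.contMDiff (w v₀)).comp v₀ hw
  have h2 : ContMDiffAt 𝓘(ℝ, V) ((𝓡 n).prod 𝓘(ℝ, ℝ)) ∞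
      (fun v => TotalSpace.mk' ℝ (E := Bundle.Trivial N ℝ) (w v)
        (h.inner (w v) (mfderiv 𝓘(ℝ, V) (𝓡 n) w v ξ) (mfderiv 𝓘(ℝ, V) (𝓡 n) w v ζ))) v₀ :=
    ContMDiffAt.clm_bundle_apply₂ (F₁ := Model n) (F₂ := Model n) h1
      (contMDiffAt_mfderiv_apply hw ξ) (contMDiffAt_mfderiv_apply hw ζ)
  rw [contMDiffAt_totalSpace] at h2
  exact contMDiffAt_iff_contDiffAt.1 h2.2


theorem contDiffAt_matrix_det {V : Type*} [NormedAddCommGroup V] [NormedSpace ℝ V]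
    {A : V → Matrix (Fin m) (Fin m) ℝ} {v : V} (hA : ∀ i j, ContDiffAt ℝ ∞ (fun v => A v i j) v) :
    ContDiffAt ℝ ∞ (fun v => (A v).det) v := by
  simp only [Matrix.det_apply']
  exact ContDiffAt.sum fun σ _ => contDiffAt_const.mul (contDiffAt_prod fun i _ => hA _ _)

/-- Cramer's rule: the entries are polynomials in those of `A` divided by the determinant. -/
theorem contDiffAt_matrix_inv {V : Type*} [NormedAddCommGroup V] [NormedSpace ℝ V]
    {A : V → Matrix (Fin m) (Fin m) ℝ} {v : V} (hA : ∀ i j, ContDiffAt ℝ ∞ (fun v => A v i j) v)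
    (hv : (A v).det ≠ 0) (i j : Fin m) : ContDiffAt ℝ ∞ (fun v => (A v)⁻¹ i j) v := by
  simp only [Matrix.inv_def, Ring.inverse_eq_inv', Matrix.smul_apply, smul_eq_mul,
    Matrix.adjugate_apply]
  refine ((contDiffAt_matrix_det hA).inv hv).mul (contDiffAt_matrix_det fun k l => ?_)
  simp only [Matrix.updateRow_apply]
  split_ifs
  · exact contDiffAt_const
  · exact hA _ _

theorem contDiffAt_trace_inv_mul {V : Type*} [NormedAddCommGroup V] [NormedSpace ℝ V]
    {A B : V → Matrix (Fin m) (Fin m) ℝ} {v : V} (hA : ∀ i j, ContDiffAt ℝ ∞ (fun v => A v i j) v)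
    (hB : ∀ i j, ContDiffAt ℝ ∞ (fun v => B v i j) v) (hv : (A v).det ≠ 0) :
    ContDiffAt ℝ ∞ (fun v => ((A v)⁻¹ * B v).trace) v := by
  simp only [Matrix.trace, Matrix.diag_apply, Matrix.mul_apply]
  exact ContDiffAt.sum fun i _ => ContDiffAt.sum fun j _ =>
    (contDiffAt_matrix_inv hA hv i j).mul (hB j i)

/-- The matrix of an endomorphism of the model space in the standard basis. -/
def endMatrix (T : Model m →L[ℝ] Model m) : Matrix (Fin m) (Fin m) ℝ :=
  Matrix.of fun i j => T (stdVec j) i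

theorem sum_smul_stdVec (v : Model m) : v = ∑ i, v i • stdVec i := by
  ext j
  simp [Finset.sum_apply, Pi.single_apply]

theorem endMatrix_det_ne_zero {T : Model m →L[ℝ] Model m} (hT : Function.Injective T) :
    (endMatrix T).det ≠ 0 := by
  intro h0
  obtain ⟨v, hv, h⟩ := Matrix.exists_mulVec_eq_zero_iff.2 h0
  apply hv
  have : T (WithLp.toLp 2 v) = 0 := by
    rw [sum_smul_stdVec (WithLp.toLp 2 v), map_sum]
    ext i
    have := congrFun h i
    simpa [endMatrix, Matrix.mulVec, dotProduct, mul_comm] using this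
  have h1 := hT (this.trans (map_zero T).symm)
  funext i
  exact congrArg (fun u : Model m => u i) h1

theorem matrix_bilin_congr (B : Model m →L[ℝ] Model m →L[ℝ] ℝ) (T : Model m →L[ℝ] Model m) :
    (Matrix.of fun i j : Fin m => B (T (stdVec i)) (T (stdVec j))) =
      (endMatrix T).transpose * (Matrix.of fun i j : Fin m => B (stdVec i) (stdVec j)) *
        endMatrix T := by
  ext i j
  conv_lhs => rw [Matrix.of_apply, sum_smul_stdVec (T (stdVec i)), sum_smul_stdVec (T (stdVec j))]
  simp only [map_sum, map_smul, sum_apply, smul_apply,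
    smul_eq_mul, Matrix.mul_apply, Matrix.transpose_apply, Matrix.of_apply, endMatrix,
    Finset.mul_sum, Finset.sum_mul]
  refine Finset.sum_congr rfl fun k _ => Finset.sum_congr rfl fun l _ => ?_
  ring

/-- The left product is conjugate to `G⁻¹ * A` by `T`. This makes the trace of one form relative to
another independent of the basis; `G` itself need not be invertible. -/
theorem trace_inv_mul_congr {G A T : Matrix (Fin m) (Fin m) ℝ} (hT : T.det ≠ 0) :
    ((T.transpose * G * T)⁻¹ * (T.transpose * A * T)).trace = (G⁻¹ * A).trace := by
  have h1 : IsUnit T.det := isUnit_iff_ne_zero.2 hT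
  have h2 : IsUnit T.transpose.det := by rwa [Matrix.det_transpose]
  rw [Matrix.mul_inv_rev, Matrix.mul_inv_rev]
  have : T⁻¹ * (G⁻¹ * T.transpose⁻¹) * (T.transpose * A * T) = T⁻¹ * (G⁻¹ * A * T) := by
    calc T⁻¹ * (G⁻¹ * T.transpose⁻¹) * (T.transpose * A * T)
        = T⁻¹ * (G⁻¹ * (T.transpose⁻¹ * T.transpose) * A * T) := by simp only [Matrix.mul_assoc]
      _ = _ := by rw [Matrix.nonsing_inv_mul _ h2, Matrix.mul_one]
  rw [this, Matrix.trace_mul_comm, Matrix.mul_assoc, Matrix.mul_nonsing_inv _ h1, Matrix.mul_one]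

theorem matrix_inner_posDef (h : Metric n N) (q : N) (T : Model m →L[ℝ] TangentSpace (𝓡 n) q)
    (hT : Function.Injective T) :
    (Matrix.of fun i j : Fin m => h.inner q (T (stdVec i)) (T (stdVec j))).PosDef := by
  refine Matrix.PosDef.of_dotProduct_mulVec_pos ?_ fun v hv => ?_
  · ext i j
    simp [h.symm q]
  · have : T (WithLp.toLp 2 v) ≠ 0 := fun h0 => hv (by
      have := hT (h0.trans (map_zero T).symm)
      funext i
      exact congrArg (fun u : Model m => u i) this)
    have h2 := h.pos q _ this
    rw [sum_smul_stdVec (WithLp.toLp 2 v)] at h2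
    simp only [map_sum, map_smul, sum_apply, smul_apply,
      smul_eq_mul] at h2
    refine h2.trans_eq ?_
    simp only [dotProduct, Matrix.mulVec, Matrix.of_apply, Finset.mul_sum, star_trivial]
    rw [Finset.sum_comm]
    refine Finset.sum_congr rfl fun k _ => Finset.sum_congr rfl fun l _ => ?_
    ring

end Smoothness

/-! ### Pullbacks, traces and their smoothness, read in charts. -/

section Charts

variable {m n : ℕ}
  {M : Type*} [TopologicalSpace M] [ChartedSpace (Model m) M] [IsManifold (𝓡 m) ∞ M]
  {M' : Type*} [TopologicalSpace M'] [ChartedSpace (Model m) M'] [IsManifold (𝓡 m) ∞ M']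
  {N : Type*} [TopologicalSpace N] [ChartedSpace (Model n) N] [IsManifold (𝓡 n) ∞ N]

theorem contMDiffAt_chart_symm (c : M) {z : Model m} (hz : z ∈ (extChartAt (𝓡 m) c).target) :
    ContMDiffAt 𝓘(ℝ, Model m) (𝓡 m) ∞ (extChartAt (𝓡 m) c).symm z :=
  (contMDiffOn_extChartAt_symm c z hz).contMDiffAt
    ((isOpen_extChartAt_target c).mem_nhds hz)

theorem contMDiffAt_chart (c : M) {x : M} (hx : x ∈ (extChartAt (𝓡 m) c).source) :
    ContMDiffAt (𝓡 m) 𝓘(ℝ, Model m) ∞ (extChartAt (𝓡 m) c) x :=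
  contMDiffAt_extChartAt' (by rwa [extChartAt_source] at hx)

theorem mfderiv_chart_mfderiv_symm (c : M) {z : Model m} (hz : z ∈ (extChartAt (𝓡 m) c).target)
    (u : Model m) :
    mfderiv (𝓡 m) 𝓘(ℝ, Model m) (extChartAt (𝓡 m) c) ((extChartAt (𝓡 m) c).symm z)
      (mfderiv 𝓘(ℝ, Model m) (𝓡 m) (extChartAt (𝓡 m) c).symm z u) = u := by
  have := mfderiv_extChartAt_comp_mfderivWithin_extChartAt_symm (I := 𝓡 m) hz
  rw [ModelWithCorners.Boundaryless.range_eq_univ, mfderivWithin_univ] at this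
  exact DFunLike.congr_fun this u

theorem mfderiv_symm_mfderiv_chart (c : M) {z : Model m} (hz : z ∈ (extChartAt (𝓡 m) c).target)
    (u : TangentSpace (𝓡 m) ((extChartAt (𝓡 m) c).symm z)) :
    mfderiv 𝓘(ℝ, Model m) (𝓡 m) (extChartAt (𝓡 m) c).symm z
      (mfderiv (𝓡 m) 𝓘(ℝ, Model m) (extChartAt (𝓡 m) c) ((extChartAt (𝓡 m) c).symm z) u) = u := by
  have := mfderivWithin_extChartAt_symm_comp_mfderiv_extChartAt (I := 𝓡 m) hz
  rw [ModelWithCorners.Boundaryless.range_eq_univ, mfderivWithin_univ] at this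
  exact DFunLike.congr_fun this u

theorem injective_mfderiv_chart_symm (c : M) {z : Model m}
    (hz : z ∈ (extChartAt (𝓡 m) c).target) :
    Function.Injective (mfderiv 𝓘(ℝ, Model m) (𝓡 m) (extChartAt (𝓡 m) c).symm z) :=
  Function.LeftInverse.injective (mfderiv_chart_mfderiv_symm c hz)

theorem pullbackMetric_id (g : Metric m M) : pullbackMetric (fun x : M => x) g = g.tensor := by
  funext x u v
  have : mfderiv (𝓡 m) (𝓡 m) (fun x : M => x) x = ContinuousLinearMap.id ℝ _ := mfderiv_id
  simp only [pullbackMetric, Metric.tensor, this]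
  rfl

theorem pullbackMetric_congr {φ φ' : M → N} (h : Metric n N) {x : M} (hφ : φ =ᶠ[𝓝 x] φ') :
    pullbackMetric (m := m) φ h x = pullbackMetric φ' h x := by
  funext u v
  simp only [pullbackMetric]
  rw [hφ.mfderiv_eq, hφ.eq_of_nhds]

theorem tensorMatrix_congr {α β : TwoTensor m M} {x : M} (h : α x = β x) :
    tensorMatrix α x = tensorMatrix β x := by
  simp only [tensorMatrix, h]

theorem pullbackMetric_comp (h : Metric n N) {φ : M → N} {χ : M' → M} {x : M'}
    (hφ : MDifferentiableAt (𝓡 m) (𝓡 n) φ (χ x)) (hχ : MDifferentiableAt (𝓡 m) (𝓡 m) χ x)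
    (u v : TangentSpace (𝓡 m) x) :
    pullbackMetric (m := m) (φ ∘ χ) h x u v = pullbackMetric (m := m) φ h (χ x)
      (mfderiv (𝓡 m) (𝓡 m) χ x u) (mfderiv (𝓡 m) (𝓡 m) χ x v) := by
  simp only [pullbackMetric]
  rw [mfderiv_comp x hφ hχ]
  rfl

/-- The chain rule in matrix form. Every tangent space is the model space by definition, so the
derivative of `χ` has a matrix in the standard bases at both ends. -/
theorem tensorMatrix_pullbackMetric_comp (h : Metric n N) {φ : M → N} {χ : M' → M} {x : M'}
    (hφ : MDifferentiableAt (𝓡 m) (𝓡 n) φ (χ x)) (hχ : MDifferentiableAt (𝓡 m) (𝓡 m) χ x) :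
    tensorMatrix (m := m) (pullbackMetric (φ ∘ χ) h) x =
      (endMatrix (mfderiv (𝓡 m) (𝓡 m) χ x)).transpose * tensorMatrix (m := m) (pullbackMetric φ h) (χ x) *
        endMatrix (mfderiv (𝓡 m) (𝓡 m) χ x) := by
  let B : Model n →L[ℝ] Model n →L[ℝ] ℝ := h.inner (φ (χ x))
  let D : Model m →L[ℝ] Model n := mfderiv (𝓡 m) (𝓡 n) φ (χ x)
  refine Eq.trans ?_ (matrix_bilin_congr (B.bilinearComp D D) (mfderiv (𝓡 m) (𝓡 m) χ x))
  ext i j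
  exact pullbackMetric_comp h hφ hχ _ _

theorem tensorMatrix_pullbackMetric_posDef (h : Metric n N) {φ : M → N} {x : M}
    (hφ : Function.Injective (mfderiv (𝓡 m) (𝓡 n) φ x)) :
    (tensorMatrix (m := m) (pullbackMetric φ h) x).PosDef :=
  matrix_inner_posDef h (φ x) (mfderiv (𝓡 m) (𝓡 n) φ x) hφ

/-- The trace of the `(0,2)` tensor field `α` with respect to `β`. -/
def relTrace (β α : TwoTensor m M) (x : M) : ℝ :=
  ((tensorMatrix β x)⁻¹ * tensorMatrix α x).trace

/-- Pulling back both forms by `χ` changes both matrices by the same congruence. This serves twice: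
to read traces in a chart, and to change variables by `ψ_{0,t}` in the energy integral. -/
theorem relTrace_comp (g : Metric m M) (h : Metric n N) {φ : M → N} {ρ : M → M} {χ : M' → M}
    {x : M'} (hφ : MDifferentiableAt (𝓡 m) (𝓡 n) φ (χ x))
    (hρ : MDifferentiableAt (𝓡 m) (𝓡 m) ρ (χ x)) (hχ : MDifferentiableAt (𝓡 m) (𝓡 m) χ x)
    (hinj : Function.Injective (mfderiv (𝓡 m) (𝓡 m) χ x)) :
    relTrace (m := m) (pullbackMetric (ρ ∘ χ) g) (pullbackMetric (φ ∘ χ) h) x =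
      relTrace (m := m) (pullbackMetric ρ g) (pullbackMetric φ h) (χ x) := by
  unfold relTrace
  rw [tensorMatrix_pullbackMetric_comp h hφ hχ, tensorMatrix_pullbackMetric_comp g hρ hχ,
    trace_inv_mul_congr (endMatrix_det_ne_zero hinj)]

/-- A family of maps is read smoothly in a chart of the source. -/
theorem contMDiffAt_family_chart {P : Type*} [NormedAddCommGroup P] [NormedSpace ℝ P]
    {ψ : P → M → N} {p : P} {c : M} {z : Model m} (hz : z ∈ (extChartAt (𝓡 m) c).target)
    (hψ : ContMDiffAt (𝓘(ℝ, P).prod (𝓡 m)) (𝓡 n) ∞ (fun q : P × M => ψ q.1 q.2)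
      (p, (extChartAt (𝓡 m) c).symm z)) :
    ContMDiffAt 𝓘(ℝ, P × Model m) (𝓡 n) ∞
      (fun q : P × Model m => ψ q.1 ((extChartAt (𝓡 m) c).symm q.2)) (p, z) := by
  have h1 : ContMDiffAt 𝓘(ℝ, P × Model m) (𝓘(ℝ, P).prod (𝓡 m)) ∞
      (fun q : P × Model m => (q.1, (extChartAt (𝓡 m) c).symm q.2)) (p, z) :=
    (contDiff_fst.contMDiff.contMDiffAt).prodMk
      ((contMDiffAt_chart_symm c hz).comp (p, z) contDiff_snd.contMDiff.contMDiffAt)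
  exact ContMDiffAt.comp (g := fun q : P × M => ψ q.1 q.2) (p, z) hψ h1

/-- Rewrites the derivative of a slice as a derivative of the joint map in a fixed direction, so
that joint smoothness in parameter and point carries over to pullbacks. -/
theorem mfderiv_family_apply {P : Type*} [NormedAddCommGroup P] [NormedSpace ℝ P]
    {w : P × Model m → N} {p : P} {z : Model m}
    (hw : MDifferentiableAt 𝓘(ℝ, P × Model m) (𝓡 n) w (p, z)) (u : Model m) :
    mfderiv 𝓘(ℝ, Model m) (𝓡 n) (fun z => w (p, z)) z u =
      mfderiv 𝓘(ℝ, P × Model m) (𝓡 n) w (p, z) (0, u) := by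
  have h1 : HasMFDerivAt 𝓘(ℝ, Model m) 𝓘(ℝ, P × Model m) (fun z => (p, z)) z
      (ContinuousLinearMap.inr ℝ P (Model m)) :=
    (hasFDerivAt_prodMk_right p z).hasMFDerivAt
  have := (HasMFDerivAt.comp z hw.hasMFDerivAt h1).mfderiv
  exact DFunLike.congr_fun this u

theorem contDiffAt_pullbackMetric_family {P : Type*} [NormedAddCommGroup P] [NormedSpace ℝ P]
    (h : Metric n N) {w : P × Model m → N} {p : P} {z : Model m}
    (hw : ∀ᶠ q in 𝓝 (p, z), ContMDiffAt 𝓘(ℝ, P × Model m) (𝓡 n) ∞ w q) (u v : Model m) :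
    ContDiffAt ℝ ∞ (fun q : P × Model m =>
      pullbackMetric (m := m) (fun z => w (q.1, z)) h q.2 u v) (p, z) := by
  refine (contDiffAt_metric_mfderiv h hw.self_of_nhds (0, u) (0, v)).congr_of_eventuallyEq ?_
  filter_upwards [hw] with q hq
  have hq' : MDifferentiableAt 𝓘(ℝ, P × Model m) (𝓡 n) w (q.1, q.2) :=
    hq.mdifferentiableAt (by simp)
  exact congrArg₂ (fun a b => h.inner (w q) a b) (mfderiv_family_apply hq' u)
    (mfderiv_family_apply hq' v)

theorem contDiffAt_tensorMatrix_pullback {P : Type*} [NormedAddCommGroup P] [NormedSpace ℝ P]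
    (h : Metric n N) {w : P × Model m → N} {p : P} {z : Model m}
    (hw : ∀ᶠ q in 𝓝 (p, z), ContMDiffAt 𝓘(ℝ, P × Model m) (𝓡 n) ∞ w q) (i j : Fin m) :
    ContDiffAt ℝ ∞ (fun q : P × Model m =>
      tensorMatrix (m := m) (pullbackMetric (fun z => w (q.1, z)) h) q.2 i j) (p, z) :=
  contDiffAt_pullbackMetric_family h hw _ _

theorem mdifferentiableAt_slice {P : Type*} [NormedAddCommGroup P] [NormedSpace ℝ P]
    {ψ : P → M → N} {q : P × M}
    (hψ : ContMDiffAt (𝓘(ℝ, P).prod (𝓡 m)) (𝓡 n) ∞ (fun q : P × M => ψ q.1 q.2) q) :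
    MDifferentiableAt (𝓡 m) (𝓡 n) (ψ q.1) q.2 :=
  (ContMDiffAt.comp (g := fun q : P × M => ψ q.1 q.2) (f := fun y : M => (q.1, y)) q.2 hψ
    (contMDiffAt_const.prodMk contMDiffAt_id)).mdifferentiableAt (by simp)

theorem eventually_contMDiffAt_family_chart {P : Type*} [NormedAddCommGroup P]
    [NormedSpace ℝ P] {ψ : P → M → N} {p : P} {x : M}
    (hψ : ∀ᶠ q in 𝓝 (p, x),
      ContMDiffAt (𝓘(ℝ, P).prod (𝓡 m)) (𝓡 n) ∞ (fun q : P × M => ψ q.1 q.2) q) :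
    ∀ᶠ q in 𝓝 (p, extChartAt (𝓡 m) x x), ContMDiffAt 𝓘(ℝ, P × Model m) (𝓡 n) ∞
      (fun q : P × Model m => ψ q.1 ((extChartAt (𝓡 m) x).symm q.2)) q := by
  have hz : extChartAt (𝓡 m) x x ∈ (extChartAt (𝓡 m) x).target := mem_extChartAt_target x
  have hT : ∀ᶠ q : P × Model m in 𝓝 (p, extChartAt (𝓡 m) x x),
      q.2 ∈ (extChartAt (𝓡 m) x).target :=
    (continuous_snd.tendsto _).eventually ((isOpen_extChartAt_target x).mem_nhds hz)
  have hcont : Tendsto (fun q : P × Model m => (q.1, (extChartAt (𝓡 m) x).symm q.2))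
      (𝓝 (p, extChartAt (𝓡 m) x x)) (𝓝 (p, x)) := by
    have : ContinuousAt (fun q : P × Model m => (q.1, (extChartAt (𝓡 m) x).symm q.2))
        (p, extChartAt (𝓡 m) x x) :=
      continuousAt_fst.prodMk
        (ContinuousAt.comp (x := (p, extChartAt (𝓡 m) x x))
          (contMDiffAt_chart_symm x hz).continuousAt continuousAt_snd)
    simpa [ContinuousAt] using this
  filter_upwards [hT, hcont.eventually hψ] with q hq1 hq2
  exact contMDiffAt_family_chart hq1 hq2

/-- With the point fixed, the chart around `x` turns `u`, `v` into constant vectors, and only the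
parameter varies. -/
theorem contDiffAt_pullbackMetric_param {P : Type*} [NormedAddCommGroup P] [NormedSpace ℝ P]
    (h : Metric n N) {ψ : P → M → N} {p : P} {x : M}
    (hψ : ∀ᶠ q in 𝓝 (p, x),
      ContMDiffAt (𝓘(ℝ, P).prod (𝓡 m)) (𝓡 n) ∞ (fun q : P × M => ψ q.1 q.2) q)
    (u v : TangentSpace (𝓡 m) x) :
    ContDiffAt ℝ ∞ (fun p => pullbackMetric (m := m) (ψ p) h x u v) p := by
  have h1 := (contDiffAt_pullbackMetric_family h (eventually_contMDiffAt_family_chart hψ)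
    (mfderiv (𝓡 m) 𝓘(ℝ, Model m) (extChartAt (𝓡 m) x) x u)
    (mfderiv (𝓡 m) 𝓘(ℝ, Model m) (extChartAt (𝓡 m) x) x v)).comp p
    (contDiff_prodMk_left (extChartAt (𝓡 m) x x)).contDiffAt
  refine h1.congr_of_eventuallyEq ?_
  have hψp : ∀ᶠ p in 𝓝 p, ContMDiffAt (𝓘(ℝ, P).prod (𝓡 m)) (𝓡 n) ∞
      (fun q : P × M => ψ q.1 q.2) (p, x) :=
    ((Continuous.prodMk_left x).tendsto p).eventually hψ
  filter_upwards [hψp] with p hp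
  have hz : extChartAt (𝓡 m) x x ∈ (extChartAt (𝓡 m) x).target := mem_extChartAt_target x
  have hσ : (extChartAt (𝓡 m) x).symm (extChartAt (𝓡 m) x x) = x := extChartAt_to_inv x
  have hev : ψ p =ᶠ[𝓝 x] (ψ p ∘ (extChartAt (𝓡 m) x).symm) ∘ extChartAt (𝓡 m) x := by
    filter_upwards [(isOpen_extChartAt_source (I := 𝓡 m) x).mem_nhds (mem_extChartAt_source x)]
      with x' hx'
    simp only [Function.comp_apply]
    rw [(extChartAt (𝓡 m) x).left_inv hx']
  have hd : MDifferentiableAt (𝓡 m) (𝓡 n) (ψ p ∘ (extChartAt (𝓡 m) x).symm)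
      (extChartAt (𝓡 m) x x) :=
    MDifferentiableAt.comp _ (by rw [hσ]; exact mdifferentiableAt_slice hp)
      ((contMDiffAt_chart_symm x hz).mdifferentiableAt (by simp))
  rw [pullbackMetric_congr h hev]
  exact pullbackMetric_comp (M := Model m) h hd
    ((contMDiffAt_chart x (mem_extChartAt_source x)).mdifferentiableAt (by simp)) u v

/-- The identification of a tangent space with the model space depends on the preferred chart at the
point, which may jump; so the matrices of the two forms need not be continuous in the point. Their
relative trace is invariant, and can be computed near `x` in the single chart around `x`. -/
theorem contMDiffAt_relTrace {P : Type*} [NormedAddCommGroup P] [NormedSpace ℝ P]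
    (g : Metric m M) (h : Metric n N) {χ : P → M → M} {ψ : P → M → N} {p : P} {x : M}
    (hχ : ∀ᶠ q in 𝓝 (p, x),
      ContMDiffAt (𝓘(ℝ, P).prod (𝓡 m)) (𝓡 m) ∞ (fun q : P × M => χ q.1 q.2) q)
    (hψ : ∀ᶠ q in 𝓝 (p, x),
      ContMDiffAt (𝓘(ℝ, P).prod (𝓡 m)) (𝓡 n) ∞ (fun q : P × M => ψ q.1 q.2) q)
    (hinj : Function.Injective (mfderiv (𝓡 m) (𝓡 m) (χ p) x)) :
    ContMDiffAt (𝓘(ℝ, P).prod (𝓡 m)) 𝓘(ℝ, ℝ) ∞ (fun q : P × M =>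
      relTrace (m := m) (pullbackMetric (χ q.1) g) (pullbackMetric (ψ q.1) h) q.2) (p, x) := by
  set σ := (extChartAt (𝓡 m) x).symm with hσ
  set z := extChartAt (𝓡 m) x x with hzdef
  have hz : z ∈ (extChartAt (𝓡 m) x).target := mem_extChartAt_target x
  have hσz : σ z = x := extChartAt_to_inv x
  have hwχ := eventually_contMDiffAt_family_chart hχ
  have hwψ := eventually_contMDiffAt_family_chart hψ
  have hF : ContDiffAt ℝ ∞ (fun q : P × Model m =>
      ((tensorMatrix (m := m) (pullbackMetric (fun z => χ q.1 (σ z)) g) q.2)⁻¹ *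
        tensorMatrix (m := m) (pullbackMetric (fun z => ψ q.1 (σ z)) h) q.2).trace) (p, z) := by
    refine contDiffAt_trace_inv_mul
      (fun i j => contDiffAt_tensorMatrix_pullback g
        (w := fun q : P × Model m => χ q.1 (σ q.2)) hwχ i j)
      (fun i j => contDiffAt_tensorMatrix_pullback h
        (w := fun q : P × Model m => ψ q.1 (σ q.2)) hwψ i j) ?_
    have hd : MDifferentiableAt (𝓡 m) (𝓡 m) (χ p) (σ z) := by
      have := mdifferentiableAt_slice hχ.self_of_nhds
      rwa [hσz]
    have hd' : MDifferentiableAt (𝓡 m) (𝓡 m) σ z :=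
      (contMDiffAt_chart_symm x hz).mdifferentiableAt (by simp)
    -- The pullback of `g` by an injective derivative is positive definite, so its matrix can be
    -- inverted.
    refine (tensorMatrix_pullbackMetric_posDef g ?_).det_pos.ne'
    have := mfderiv_comp z hd hd'
    intro u v huv
    apply injective_mfderiv_chart_symm x hz
    have hinj' : Function.Injective (mfderiv (𝓡 m) (𝓡 m) (χ p) (σ z)) := by rwa [hσz]
    apply hinj'
    have h1 := DFunLike.congr_fun this u
    have h2 := DFunLike.congr_fun this v
    exact h1.symm.trans (huv.trans h2)
  have hcomp : ContMDiffAt (𝓘(ℝ, P).prod (𝓡 m)) 𝓘(ℝ, P × Model m) ∞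
      (fun q : P × M => (q.1, extChartAt (𝓡 m) x q.2)) (p, x) :=
    contMDiffAt_fst.prodMk_space
      ((contMDiffAt_chart x (mem_extChartAt_source x)).comp (p, x) contMDiffAt_snd)
  refine (ContMDiffAt.comp (p, x) (contMDiffAt_iff_contDiffAt.2 hF)
    hcomp).congr_of_eventuallyEq ?_
  have hS : ∀ᶠ q : P × M in 𝓝 (p, x), q.2 ∈ (extChartAt (𝓡 m) x).source :=
    (continuous_snd.tendsto (p, x)).eventually
      ((isOpen_extChartAt_source x).mem_nhds (mem_extChartAt_source x))
  filter_upwards [hS, hχ, hψ] with q hq hqχ hqψ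
  have hq' : σ (extChartAt (𝓡 m) x q.2) = q.2 := (extChartAt (𝓡 m) x).left_inv hq
  have hqt := (extChartAt (𝓡 m) x).map_source hq
  have := relTrace_comp g h (φ := ψ q.1) (ρ := χ q.1) (χ := σ) (x := extChartAt (𝓡 m) x q.2)
    (by rw [hq']; exact mdifferentiableAt_slice hqψ) (by rw [hq']; exact mdifferentiableAt_slice hqχ)
    ((contMDiffAt_chart_symm x hqt).mdifferentiableAt (by simp))
    (injective_mfderiv_chart_symm x hqt)
  rw [hq'] at this
  exact this.symm

end Charts

/-! ### The Lie derivative as the derivative of pullbacks. -/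

section LieDerivative

variable {m n : ℕ}
  {M : Type*} [TopologicalSpace M] [ChartedSpace (Model m) M] [IsManifold (𝓡 m) ∞ M]
  {N : Type*} [TopologicalSpace N] [ChartedSpace (Model n) N] [IsManifold (𝓡 n) ∞ N]

/-- In finite dimension `B z = ∑ᵢ eᵢ^* ⊗ B z eᵢ` for a basis `eᵢ`, a finite sum of fixed linear
images of the values `B z eᵢ`. -/
theorem differentiableAt_clm_of_apply {E H V : Type*} [NormedAddCommGroup E] [NormedSpace ℝ E]
    [FiniteDimensional ℝ E] [NormedAddCommGroup H] [NormedSpace ℝ H] [NormedAddCommGroup V]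
    [NormedSpace ℝ V] {B : V → E →L[ℝ] H} {z : V}
    (hB : ∀ u, DifferentiableAt ℝ (fun z => B z u) z) : DifferentiableAt ℝ B z := by
  let e := Module.finBasis ℝ E
  let p : Fin (Module.finrank ℝ E) → (E →L[ℝ] ℝ) := fun i =>
    LinearMap.toContinuousLinearMap (e.coord i)
  have hE : B = fun z => ∑ i, ContinuousLinearMap.smulRightL ℝ E H (p i) (B z (e i)) := by
    funext z
    ext u
    have h1 : ∑ i, ContinuousLinearMap.smulRightL ℝ E H (p i) (B z (e i)) =
        ∑ i, (p i).smulRight (B z (e i)) := rfl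
    rw [h1]
    simp only [p, sum_apply, ContinuousLinearMap.smulRight_apply,
      LinearMap.coe_toContinuousLinearMap', Module.Basis.coord_apply]
    conv_lhs => rw [← e.sum_repr u]
    simp only [map_sum, map_smul]
  rw [hE]
  exact DifferentiableAt.fun_sum fun i _ =>
    (ContinuousLinearMap.smulRightL ℝ E H (p i)).differentiableAt.comp z (hB (e i))

theorem hasDerivAt_clm_family {E H V : Type*} [NormedAddCommGroup E] [NormedSpace ℝ E]
    [FiniteDimensional ℝ E] [NormedAddCommGroup H] [NormedSpace ℝ H] [NormedAddCommGroup V]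
    [NormedSpace ℝ V] {B : V → E →L[ℝ] H} {y ξ : V} {a' : E} {γ : ℝ → V} {a : ℝ → E}
    (hB : ∀ u, DifferentiableAt ℝ (fun z => B z u) y)
    (hγ : HasDerivAt γ ξ 0) (hγ0 : γ 0 = y) (ha : HasDerivAt a a' 0) :
    HasDerivAt (fun s => B (γ s) (a s)) (fderiv ℝ (fun z => B z (a 0)) y ξ + B y a') 0 := by
  have hBd : HasFDerivAt B (fderiv ℝ B y) y := (differentiableAt_clm_of_apply hB).hasFDerivAt
  have h1 : HasFDerivAt B (fderiv ℝ B y) (γ 0) := hγ0 ▸ hBd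
  have h2 : HasFDerivAt (fun z => B z (a 0)) ((fderiv ℝ B y).flip (a 0)) y := by
    simpa using hBd.clm_apply (hasFDerivAt_const (a 0) y)
  refine ((h1.comp_hasDerivAt (0 : ℝ) hγ).clm_apply ha).congr_deriv ?_
  rw [h2.fderiv]
  simp [hγ0]

theorem hasDerivAt_bilin_family {E : Type*} [NormedAddCommGroup E] [NormedSpace ℝ E]
    [FiniteDimensional ℝ E] {B : E → E →L[ℝ] E →L[ℝ] ℝ} {y ξ a' b' : E} {γ a b : ℝ → E}
    (hB : ∀ u v, DifferentiableAt ℝ (fun z => B z u v) y)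
    (hγ : HasDerivAt γ ξ 0) (hγ0 : γ 0 = y) (ha : HasDerivAt a a' 0) (hb : HasDerivAt b b' 0) :
    HasDerivAt (fun s => B (γ s) (a s) (b s))
      (fderiv ℝ (fun z => B z (a 0) (b 0)) y ξ + B y a' (b 0) + B y (a 0) b') 0 := by
  have hB' : ∀ u, DifferentiableAt ℝ (fun z => B z u) y := fun u =>
    differentiableAt_clm_of_apply (hB u)
  have h2 : HasFDerivAt (fun z => B z (a 0) (b 0))
      ((fderiv ℝ (fun z => B z (a 0)) y).flip (b 0)) y := by
    simpa using (hB' (a 0)).hasFDerivAt.clm_apply (hasFDerivAt_const (b 0) y)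
  refine ((hasDerivAt_clm_family hB' hγ hγ0 ha).clm_apply hb).congr_deriv ?_
  rw [h2.fderiv]
  simp [hγ0]

/-- Symmetry of second derivatives: the time derivative of the spatial derivative of `w` is the
spatial derivative of its velocity. This produces the terms `α(DX u, v)` and `α(u, DX v)` of the Lie
derivative. -/
theorem hasDerivAt_fderiv_of_velocity {V W : Type*} [NormedAddCommGroup V] [NormedSpace ℝ V]
    [NormedAddCommGroup W] [NormedSpace ℝ W] {w : ℝ × V → W} {Y : V → W} {y : V}
    (hw : ContDiffAt ℝ 2 w (0, y)) (hY : ∀ᶠ z in 𝓝 y, fderiv ℝ w (0, z) (1, 0) = Y z) (a : V) :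
    HasDerivAt (fun s => fderiv ℝ w (s, y) (0, a)) (fderiv ℝ Y y a) 0 := by
  have hdw : HasFDerivAt (fderiv ℝ w) (fderiv ℝ (fderiv ℝ w) (0, y)) (0, y) :=
    ((hw.fderiv_right (m := 1) (by norm_num)).differentiableAt (by simp)).hasFDerivAt
  have h1 : HasFDerivAt (fun q => fderiv ℝ w q (0, a))
      ((fderiv ℝ (fderiv ℝ w) (0, y)).flip (0, a)) (0, y) := by
    simpa using hdw.clm_apply (hasFDerivAt_const ((0 : ℝ), a) ((0 : ℝ), y))
  have h2 : HasFDerivAt (fun q => fderiv ℝ w q (1, 0))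
      ((fderiv ℝ (fderiv ℝ w) (0, y)).flip (1, 0)) (0, y) := by
    simpa using hdw.clm_apply (hasFDerivAt_const ((1 : ℝ), (0 : V)) ((0 : ℝ), y))
  have h3 := h1.comp_hasDerivAt (0 : ℝ) (f := fun s : ℝ => (s, y))
    ((hasDerivAt_id (0 : ℝ)).prodMk (hasDerivAt_const _ _))
  have h4 : HasFDerivAt (fun z : V => fderiv ℝ w (0, z) (1, 0)) _ y :=
    HasFDerivAt.comp (f := fun z : V => ((0 : ℝ), z)) y h2 (hasFDerivAt_prodMk_right (0 : ℝ) y)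
  have h5 := (h4.congr_of_eventuallyEq (hY.mono fun z hz => hz.symm)).fderiv
  have hsymm : IsSymmSndFDerivAt ℝ w (0, y) := hw.isSymmSndFDerivAt (by simp)
  refine h3.congr_deriv ?_
  rw [h5]
  exact hsymm (1, 0) (0, a)

theorem coordField_apply (X : VField m M) (c : M) {z : Model m}
    (hz : z ∈ (extChartAt (𝓡 m) c).target) :
    coordField X c z = mfderiv (𝓡 m) 𝓘(ℝ, Model m) (extChartAt (𝓡 m) c)
      ((extChartAt (𝓡 m) c).symm z) (X ((extChartAt (𝓡 m) c).symm z)) := by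
  have := ContinuousLinearMap.inverse_eq
    (f := mfderiv 𝓘(ℝ, Model m) (𝓡 m) (extChartAt (𝓡 m) c).symm z)
    (g := mfderiv (𝓡 m) 𝓘(ℝ, Model m) (extChartAt (𝓡 m) c) ((extChartAt (𝓡 m) c).symm z))
    (ContinuousLinearMap.ext (mfderiv_symm_mfderiv_chart c hz))
    (ContinuousLinearMap.ext (mfderiv_chart_mfderiv_symm c hz))
  rw [coordField, VectorField.mpullback_apply, this]
  rfl

theorem coordTensor_pullbackMetric (h : Metric n N) {φ : M → N} (c : M) {z : Model m}
    (hz : z ∈ (extChartAt (𝓡 m) c).target)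
    (hφ : MDifferentiableAt (𝓡 m) (𝓡 n) φ ((extChartAt (𝓡 m) c).symm z)) (u v : Model m) :
    coordTensor (pullbackMetric φ h) c z u v =
      pullbackMetric (m := m) (φ ∘ (extChartAt (𝓡 m) c).symm) h z u v :=
  (pullbackMetric_comp h hφ ((contMDiffAt_chart_symm c hz).mdifferentiableAt (by simp)) u v).symm

/-- The velocity in a chart of a family of maps whose velocity at time `0` is `X`. -/
theorem fderiv_chart_family (X : VField m M) {ψ : ℝ → M → M} {c x : M}
    (hx : x ∈ (extChartAt (𝓡 m) c).source)
    (hψ : ContMDiffAt (𝓘(ℝ, ℝ).prod (𝓡 m)) (𝓡 m) ∞ (fun q : ℝ × M => ψ q.1 q.2) (0, x))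
    (h0 : ψ 0 x = x)
    (hX : (⟨ψ 0 x, mfderiv 𝓘(ℝ, ℝ) (𝓡 m) (fun s : ℝ => ψ s x) 0 (1 : ℝ)⟩ : TangentBundle (𝓡 m) M)
      = ⟨x, X x⟩) :
    HasDerivAt (fun s => extChartAt (𝓡 m) c (ψ s x))
      (coordField X c (extChartAt (𝓡 m) c x)) 0 := by
  have hd : MDifferentiableAt 𝓘(ℝ, ℝ) (𝓡 m) (fun s : ℝ => ψ s x) 0 :=
    (ContMDiffAt.comp (g := fun q : ℝ × M => ψ q.1 q.2) (f := fun s : ℝ => (s, x)) 0 hψ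
      (contMDiffAt_id.prodMk contMDiffAt_const)).mdifferentiableAt (by simp)
  have he : MDifferentiableAt (𝓡 m) 𝓘(ℝ, Model m) (extChartAt (𝓡 m) c) (ψ 0 x) :=
    (contMDiffAt_chart c (by rwa [h0])).mdifferentiableAt (by simp)
  let D : ℝ →L[ℝ] Model m := (mfderiv (𝓡 m) 𝓘(ℝ, Model m) (extChartAt (𝓡 m) c) (ψ 0 x)).comp
    (mfderiv 𝓘(ℝ, ℝ) (𝓡 m) (fun s : ℝ => ψ s x) 0)
  have h1 : HasFDerivAt (fun s => extChartAt (𝓡 m) c (ψ s x)) D 0 :=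
    (HasMFDerivAt.comp 0 he.hasMFDerivAt hd.hasMFDerivAt).hasFDerivAt
  -- The equality `hX` lives in the total space; applying a function on the total space avoids
  -- transporting vectors between the fibres over `ψ 0 x` and `x`.
  have h2 := congrArg (fun v : TangentBundle (𝓡 m) M =>
    (mfderiv (𝓡 m) 𝓘(ℝ, Model m) (extChartAt (𝓡 m) c) v.1 v.2 : Model m)) hX
  have h3 := coordField_apply X c ((extChartAt (𝓡 m) c).map_source hx)
  rw [(extChartAt (𝓡 m) c).left_inv hx] at h3
  rw [h3]
  exact h1.hasDerivAt.congr_deriv h2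

/-- The Lie derivative of a pulled back metric along `X` is the derivative of its pullbacks by
any family of maps through the identity whose velocity is `X`. -/
theorem hasDerivAt_pullbackMetric_family (X : VField m M) (h : Metric n N) {φ : M → N}
    {ψ : ℝ → M → M} {x : M} (hφ : ∀ᶠ x' in 𝓝 x, ContMDiffAt (𝓡 m) (𝓡 n) ∞ φ x')
    (hψ : ∀ᶠ q in 𝓝 ((0 : ℝ), x),
      ContMDiffAt (𝓘(ℝ, ℝ).prod (𝓡 m)) (𝓡 m) ∞ (fun q : ℝ × M => ψ q.1 q.2) q)
    (h0 : ∀ᶠ x' in 𝓝 x, ψ 0 x' = x')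
    (hX : ∀ᶠ x' in 𝓝 x, (⟨ψ 0 x', mfderiv 𝓘(ℝ, ℝ) (𝓡 m) (fun s : ℝ => ψ s x') 0 (1 : ℝ)⟩ :
      TangentBundle (𝓡 m) M) = ⟨x', X x'⟩) (u v : TangentSpace (𝓡 m) x) :
    HasDerivAt (fun s => pullbackMetric (m := m) (φ ∘ ψ s) h x u v)
      (lieDerivative X (pullbackMetric φ h) x u v) 0 := by
  set e := extChartAt (𝓡 m) x with he
  set y : Model m := e x with hy
  have hyt : y ∈ e.target := mem_extChartAt_target x
  have hσy : e.symm y = x := extChartAt_to_inv x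
  set u' : Model m := mfderiv (𝓡 m) 𝓘(ℝ, Model m) e x u with hu'
  set v' : Model m := mfderiv (𝓡 m) 𝓘(ℝ, Model m) e x v with hv'
  have hT : ∀ᶠ z in 𝓝 y, z ∈ e.target := (isOpen_extChartAt_target x).mem_nhds hyt
  have hσc : Tendsto e.symm (𝓝 y) (𝓝 x) := by
    have := (contMDiffAt_chart_symm x hyt).continuousAt
    rwa [ContinuousAt, ← he, hσy] at this
  have hψ0 : ψ 0 x = x := h0.self_of_nhds
  -- the family in the chart
  set w : ℝ × Model m → Model m := fun q => e (ψ q.1 (e.symm q.2)) with hw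
  have hψc : ContinuousAt (fun q : ℝ × M => ψ q.1 q.2) (0, x) := hψ.self_of_nhds.continuousAt
  have hS : ∀ᶠ q in 𝓝 ((0 : ℝ), x), ψ q.1 q.2 ∈ e.source :=
    hψc.eventually ((isOpen_extChartAt_source x).mem_nhds (by
      simp [hψ0]))
  have hcont : Tendsto (fun q : ℝ × Model m => (q.1, e.symm q.2)) (𝓝 (0, y)) (𝓝 (0, x)) := by
    rw [nhds_prod_eq, nhds_prod_eq]
    exact tendsto_fst.prodMk (hσc.comp tendsto_snd)
  have hwsm : ∀ᶠ q in 𝓝 ((0 : ℝ), y), ContDiffAt ℝ ∞ w q := by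
    filter_upwards [hcont.eventually hψ, hcont.eventually hS,
      (continuous_snd.tendsto ((0 : ℝ), y)).eventually hT] with q hq hq' hq''
    have h1 := contMDiffAt_family_chart hq'' hq
    have h2 := (contMDiffAt_chart x hq').comp q h1
    exact contMDiffAt_iff_contDiffAt.1 h2
  have hw0 : ContDiffAt ℝ ∞ w (0, y) := hwsm.self_of_nhds
  have hw0y : w (0, y) = y := by simp only [hw, hσy, hψ0, ← hy]
  -- the velocity in the chart
  have hvel : ∀ᶠ z in 𝓝 y, fderiv ℝ w (0, z) (1, 0) = coordField X x z := by
    have hw' : ∀ᶠ z in 𝓝 y, ContDiffAt ℝ ∞ w (0, z) :=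
      ((Continuous.prodMk_right (0 : ℝ)).tendsto y).eventually hwsm
    have hψ' : ∀ᶠ x' in 𝓝 x, ContMDiffAt (𝓘(ℝ, ℝ).prod (𝓡 m)) (𝓡 m) ∞
        (fun q : ℝ × M => ψ q.1 q.2) (0, x') :=
      ((Continuous.prodMk_right (0 : ℝ)).tendsto x).eventually hψ
    filter_upwards [hw', hT, hσc.eventually hX, hσc.eventually h0, hσc.eventually hψ']
      with z hz1 hz2 hz3 hz4 hz5
    have h1 := fderiv_chart_family X (e.map_target hz2) hz5 hz4 hz3
    rw [← he, e.right_inv hz2] at h1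
    have h2 : HasDerivAt (fun s : ℝ => (s, z)) ((1 : ℝ), (0 : Model m)) 0 :=
      (hasDerivAt_id (0 : ℝ)).prodMk (hasDerivAt_const _ _)
    have h3 := ((hz1.differentiableAt (by simp)).hasFDerivAt).comp_hasDerivAt (0 : ℝ) h2
    exact h3.unique h1
  have hγ : HasDerivAt (fun s => w (s, y)) (coordField X x y) 0 := by
    have h2 : HasDerivAt (fun s : ℝ => (s, y)) ((1 : ℝ), (0 : Model m)) 0 :=
      (hasDerivAt_id (0 : ℝ)).prodMk (hasDerivAt_const _ _)
    have h3 := ((hw0.differentiableAt (by simp)).hasFDerivAt).comp_hasDerivAt (0 : ℝ) h2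
    rwa [hvel.self_of_nhds] at h3
  have hδ : ∀ a : Model m, HasDerivAt (fun s => fderiv ℝ w (s, y) (0, a))
      (fderiv ℝ (coordField X x) y a) 0 :=
    fun a => hasDerivAt_fderiv_of_velocity (hw0.of_le (by norm_cast)) hvel a
  have hDw : ∀ᶠ s in 𝓝 (0 : ℝ), ∀ a : Model m,
      mfderiv 𝓘(ℝ, Model m) 𝓘(ℝ, Model m) (fun z => w (s, z)) y a = fderiv ℝ w (s, y) (0, a) := by
    have : ∀ᶠ s in 𝓝 (0 : ℝ), ContDiffAt ℝ ∞ w (s, y) :=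
      ((Continuous.prodMk_left y).tendsto (0 : ℝ)).eventually hwsm
    filter_upwards [this] with s hs a
    rw [mfderiv_family_apply (hs.contMDiffAt.mdifferentiableAt (by simp)) a, mfderiv_eq_fderiv]
    rfl
  -- the bilinear form in the chart
  let B : Model m → Model m →L[ℝ] Model m →L[ℝ] ℝ := fun z =>
    let b : Model n →L[ℝ] Model n →L[ℝ] ℝ := h.inner (φ (e.symm z))
    let D : Model m →L[ℝ] Model n := mfderiv 𝓘(ℝ, Model m) (𝓡 n) (φ ∘ e.symm) z
    b.bilinearComp D D
  have hBd : ∀ a b, DifferentiableAt ℝ (fun z => B z a b) y := fun a b =>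
    (contDiffAt_metric_mfderiv h (w := φ ∘ e.symm) (v₀ := y)
      (ContMDiffAt.comp y (by rw [hσy]; exact hφ.self_of_nhds) (contMDiffAt_chart_symm x hyt))
      a b).differentiableAt (by simp)
  have hBc : ∀ᶠ z in 𝓝 y, ∀ a b, coordTensor (pullbackMetric φ h) x z a b = B z a b := by
    filter_upwards [hT, hσc.eventually hφ] with z hz hz' a b
    exact coordTensor_pullbackMetric h x hz (hz'.mdifferentiableAt (by simp)) a b
  have hkey : ∀ᶠ s in 𝓝 (0 : ℝ), pullbackMetric (m := m) (φ ∘ ψ s) h x u v =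
      B (w (s, y)) (fderiv ℝ w (s, y) (0, u')) (fderiv ℝ w (s, y) (0, v')) := by
    have hS' : ∀ᶠ s in 𝓝 (0 : ℝ), ∀ᶠ x' in 𝓝 x, ψ s x' ∈ e.source := by
      have := hS
      rw [nhds_prod_eq] at this
      exact this.curry
    have hws : ∀ᶠ s in 𝓝 (0 : ℝ), ContDiffAt ℝ ∞ w (s, y) :=
      ((Continuous.prodMk_left y).tendsto (0 : ℝ)).eventually hwsm
    have hφs : ∀ᶠ s in 𝓝 (0 : ℝ), ContMDiffAt (𝓡 m) (𝓡 n) ∞ φ (e.symm (w (s, y))) := by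
      have : Tendsto (fun s => e.symm (w (s, y))) (𝓝 0) (𝓝 x) := by
        have h1 : Tendsto (fun s => w (s, y)) (𝓝 0) (𝓝 y) := by
          have := hγ.continuousAt
          rwa [ContinuousAt, hw0y] at this
        exact hσc.comp h1
      exact this.eventually hφ
    have hTs : ∀ᶠ s in 𝓝 (0 : ℝ), w (s, y) ∈ e.target := by
      have h1 : Tendsto (fun s => w (s, y)) (𝓝 0) (𝓝 y) := by
        have := hγ.continuousAt
        rwa [ContinuousAt, hw0y] at this
      exact h1.eventually hT
    filter_upwards [hS', hws, hφs, hTs, hDw] with s hs hws hφs hTs hDs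
    -- Factoring through the chart splits the pullback into the form `B` of `φ ∘ e.symm`, evaluated
    -- at the moving point `w (s, y)` on the images of `u'` and `v'` under the derivative of `w (s,
    -- ·)`.
    have hcongr : φ ∘ ψ s =ᶠ[𝓝 x] ((φ ∘ e.symm) ∘ fun z => w (s, z)) ∘ e := by
      filter_upwards [hs, (isOpen_extChartAt_source (I := 𝓡 m) x).mem_nhds
        (mem_extChartAt_source x)] with x' hx' hx''
      simp only [Function.comp_apply, hw]
      rw [e.left_inv hx'', e.left_inv hx']
    have hd1 : MDifferentiableAt 𝓘(ℝ, Model m) (𝓡 n) (φ ∘ e.symm) (w (s, y)) :=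
      (ContMDiffAt.comp _ hφs (contMDiffAt_chart_symm x hTs)).mdifferentiableAt (by simp)
    have hd2 : MDifferentiableAt 𝓘(ℝ, Model m) 𝓘(ℝ, Model m) (fun z => w (s, z)) y :=
      (ContDiffAt.comp y hws (contDiff_prodMk_right s).contDiffAt).contMDiffAt.mdifferentiableAt
        (by simp)
    rw [pullbackMetric_congr h hcongr,
      pullbackMetric_comp (M := Model m) (φ := (φ ∘ e.symm) ∘ fun z => w (s, z)) (χ := e) h
        (MDifferentiableAt.comp y hd1 hd2)
        ((contMDiffAt_chart x (mem_extChartAt_source x)).mdifferentiableAt (by simp)),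
      pullbackMetric_comp (M := Model m) (M' := Model m) (φ := φ ∘ e.symm)
        (χ := fun z => w (s, z)) h hd1 hd2]
    exact congrArg₂ (fun a b : Model m => B (w (s, y)) a b) (hDs u') (hDs v')
  have hDw0 : ∀ a : Model m, fderiv ℝ w (0, y) (0, a) = a := by
    intro a
    rw [← hDw.self_of_nhds a]
    have : (fun z => w (0, z)) =ᶠ[𝓝 y] id := by
      filter_upwards [hT, hσc.eventually h0] with z hz hz'
      simp only [hw, hz', id]
      exact e.right_inv hz
    rw [this.mfderiv_eq, mfderiv_id]
    rfl
  refine ((hasDerivAt_bilin_family hBd hγ hw0y (hδ u') (hδ v')).congr_of_eventuallyEq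
    hkey).congr_deriv ?_
  have hfd : (fun z : Model m => coordTensor (pullbackMetric φ h) x z u' v') =ᶠ[𝓝 y]
      fun z => B z u' v' := hBc.mono fun z hz => hz u' v'
  have hB0 := hBc.self_of_nhds
  simp only [lieDerivative]
  rw [← he, ← hy, ← hu', ← hv', hfd.fderiv_eq, hB0, hB0, hDw0, hDw0]

end LieDerivative

/-! ### Chart volumes and local finiteness of the Riemannian volume. -/

section Volume

variable {m : ℕ}
  {M : Type*} [TopologicalSpace M] [ChartedSpace (Model m) M] [IsManifold (𝓡 m) ∞ M]

theorem endMatrix_det (T : Model m →L[ℝ] Model m) : (endMatrix T).det = T.det := by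
  have h : endMatrix T = LinearMap.toMatrix (EuclideanSpace.basisFun (Fin m) ℝ).toBasis
      (EuclideanSpace.basisFun (Fin m) ℝ).toBasis (T : Model m →ₗ[ℝ] Model m) := by
    ext i j
    simp [endMatrix, LinearMap.toMatrix_apply]
  rw [h, LinearMap.det_toMatrix]

theorem coordDensity_eq (g : Metric m M) (c : M) (z : Model m) :
    coordDensity g c z = Real.sqrt
      (tensorMatrix (m := m) (pullbackMetric (extChartAt (𝓡 m) c).symm g) z).det := rfl

/-- The Gram matrices in the two charts are congruent by the Jacobian of the transition map, so
their determinants differ by its squared determinant. -/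
theorem coordDensity_change (g : Metric m M) {c c' : M} {z : Model m}
    (hz : z ∈ (extChartAt (𝓡 m) c').target)
    (hz' : (extChartAt (𝓡 m) c').symm z ∈ (extChartAt (𝓡 m) c).source) :
    coordDensity g c' z =
      |(fderiv ℝ (extChartAt (𝓡 m) c ∘ (extChartAt (𝓡 m) c').symm) z).det| *
        coordDensity g c ((extChartAt (𝓡 m) c ∘ (extChartAt (𝓡 m) c').symm) z) := by
  have h1 := contMDiffAt_chart_symm c' hz
  have hev : (extChartAt (𝓡 m) c').symm =ᶠ[𝓝 z] (extChartAt (𝓡 m) c).symm ∘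
      (extChartAt (𝓡 m) c ∘ (extChartAt (𝓡 m) c').symm) := by
    filter_upwards [h1.continuousAt.eventually
      ((isOpen_extChartAt_source c).mem_nhds hz')] with y hy
    exact ((extChartAt (𝓡 m) c).left_inv hy).symm
  have h2 := tensorMatrix_pullbackMetric_comp (M' := Model m) g (φ := (extChartAt (𝓡 m) c).symm)
    (χ := extChartAt (𝓡 m) c ∘ (extChartAt (𝓡 m) c').symm) (x := z)
    ((contMDiffAt_chart_symm c ((extChartAt (𝓡 m) c).map_source hz')).mdifferentiableAt (by simp))
    (((contMDiffAt_chart c hz').comp z h1).mdifferentiableAt (by simp))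
  have h3 : (endMatrix (mfderiv 𝓘(ℝ, Model m) (𝓡 m)
      (extChartAt (𝓡 m) c ∘ (extChartAt (𝓡 m) c').symm) z)).det =
      (fderiv ℝ (extChartAt (𝓡 m) c ∘ (extChartAt (𝓡 m) c').symm) z).det :=
    (congrArg (fun T : Model m →L[ℝ] Model m => (endMatrix T).det) mfderiv_eq_fderiv).trans
      (endMatrix_det _)
  rw [coordDensity_eq, coordDensity_eq,
    tensorMatrix_congr (m := m) (pullbackMetric_congr (m := m) g hev), h2, Matrix.det_mul,
    Matrix.det_mul, Matrix.det_transpose, h3]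
  rw [mul_right_comm, Real.sqrt_mul (mul_self_nonneg _), Real.sqrt_mul_self_eq_abs]

theorem continuousAt_coordDensity (g : Metric m M) (c : M) {z : Model m}
    (hz : z ∈ (extChartAt (𝓡 m) c).target) : ContinuousAt (coordDensity g c) z := by
  refine Real.continuous_sqrt.continuousAt.comp (x := z) (contDiffAt_matrix_det fun i j =>
    contDiffAt_metric_mfderiv g (contMDiffAt_chart_symm c hz) _ _).continuousAt

variable [MeasurableSpace M] [BorelSpace M]

theorem measurableSet_target_inter_preimage (c : M) {A : Set M} (hA : MeasurableSet A) :
    MeasurableSet ((extChartAt (𝓡 m) c).symm ⁻¹' A ∩ (extChartAt (𝓡 m) c).target) := by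
  have h1 : Continuous ((extChartAt (𝓡 m) c).target.domRestrict (extChartAt (𝓡 m) c).symm) :=
    (continuousOn_extChartAt_symm c).domRestrict
  have h2 := (isOpen_extChartAt_target (I := 𝓡 m) c).measurableSet.subtype_image
    (h1.measurable hA)
  convert h2 using 1
  ext z
  simp [and_comm]

theorem chartVolume_apply (g : Metric m M) (c : M) {A : Set M} (hA : MeasurableSet A) :
    chartVolume g c A = ∫⁻ y in (extChartAt (𝓡 m) c).symm ⁻¹' A ∩ (extChartAt (𝓡 m) c).target,
      ENNReal.ofReal (coordDensity g c y) := by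
  have ht : MeasurableSet (extChartAt (𝓡 m) c).target :=
    (isOpen_extChartAt_target (I := 𝓡 m) c).measurableSet
  have h1 : AEMeasurable (extChartAt (𝓡 m) c).symm
      ((volume.restrict (extChartAt (𝓡 m) c).target).withDensity
        fun y => ENNReal.ofReal (coordDensity g c y)) :=
    ((continuousOn_extChartAt_symm c).aemeasurable ht).mono_ac
      (withDensity_absolutelyContinuous _ _)
  rw [chartVolume, Measure.map_apply_of_aemeasurable h1 hA, withDensity_apply' _ _,
    Measure.restrict_restrict' ht]

/-- Change of variables by the transition map. Only an inequality holds, because the chart around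
`c'` sees just the part of `A` in its own domain. -/
theorem chartVolume_le (g : Metric m M) (c c' : M) {A : Set M} (hA : MeasurableSet A)
    (hAc : A ⊆ (extChartAt (𝓡 m) c).source) : chartVolume g c' A ≤ chartVolume g c A := by
  rw [chartVolume_apply g c' hA, chartVolume_apply g c hA]
  set B := (extChartAt (𝓡 m) c').symm ⁻¹' A ∩ (extChartAt (𝓡 m) c').target
  have hB : MeasurableSet B := measurableSet_target_inter_preimage c' hA
  set τ : Model m → Model m := extChartAt (𝓡 m) c ∘ (extChartAt (𝓡 m) c').symm
  have hd : ∀ z ∈ B, HasFDerivWithinAt τ (fderiv ℝ τ z) B z := fun z hz => by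
    have : ContDiffAt ℝ ∞ τ z := contMDiffAt_iff_contDiffAt.1
      ((contMDiffAt_chart c (hAc hz.1)).comp z (contMDiffAt_chart_symm c' hz.2))
    exact (this.differentiableAt (by simp)).hasFDerivAt.hasFDerivWithinAt
  have hinj : InjOn τ B := fun z hz z' hz' h =>
    (extChartAt (𝓡 m) c').symm.injOn (by simpa using hz.2) (by simpa using hz'.2)
      ((extChartAt (𝓡 m) c).injOn (hAc hz.1) (hAc hz'.1) h)
  have h1 := lintegral_image_eq_lintegral_abs_det_fderiv_mul volume hB hd hinj
    fun y => ENNReal.ofReal (coordDensity g c y)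
  have h2 : ∫⁻ y in B, ENNReal.ofReal (coordDensity g c' y) =
      ∫⁻ y in B, ENNReal.ofReal |(fderiv ℝ τ y).det| * ENNReal.ofReal (coordDensity g c (τ y)) := by
    refine setLIntegral_congr_fun hB fun z hz => ?_
    rw [coordDensity_change g hz.2 (hAc hz.1), ENNReal.ofReal_mul (abs_nonneg _)]
  rw [h2, ← h1]
  refine lintegral_mono_set ?_
  rintro _ ⟨z, hz, rfl⟩
  refine ⟨?_, (extChartAt (𝓡 m) c).map_source (hAc hz.1)⟩
  have : (extChartAt (𝓡 m) c).symm (τ z) = (extChartAt (𝓡 m) c').symm z :=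
    (extChartAt (𝓡 m) c).left_inv (hAc hz.1)
  rw [mem_preimage, this]
  exact hz.1

theorem riemannianVolume_le (g : Metric m M) (c : M) {A : Set M} (hA : MeasurableSet A)
    (hAc : A ⊆ (extChartAt (𝓡 m) c).source) : riemannianVolume g A ≤ chartVolume g c A := by
  have hS : MeasurableSet (extChartAt (𝓡 m) c).source :=
    (isOpen_extChartAt_source (I := 𝓡 m) c).measurableSet
  set S := (extChartAt (𝓡 m) c).source
  -- A supremum of measures is not computed set by set, so one measure dominating all chart volumes
  -- is exhibited. On the chart domain it is the volume of that chart; off the domain it is infinite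
  -- on every nonempty set, so nothing has to be checked there.
  have key : riemannianVolume g ≤ (chartVolume g c).restrict S +
      ((⊤ : ENNReal) • Measure.count).restrict Sᶜ := by
    refine iSup_le fun c' => Measure.le_iff.2 fun B hB => ?_
    rw [Measure.add_apply, Measure.restrict_apply hB, Measure.restrict_apply hB]
    rcases (B ∩ Sᶜ).eq_empty_or_nonempty with h | h
    · have hBS : B ⊆ S := by
        rwa [← sdiff_eq, sdiff_eq_empty] at h
      rw [inter_eq_left.2 hBS]
      exact (chartVolume_le g c c' hB hBS).trans le_self_add
    · have : ((⊤ : ENNReal) • Measure.count) (B ∩ Sᶜ) = ⊤ := by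
        rw [Measure.smul_apply, smul_eq_mul, ENNReal.top_mul]
        exact (Measure.count_ne_zero_iff).2 h
      rw [this]
      simp
  refine (key A).trans ?_
  rw [Measure.add_apply, Measure.restrict_apply hA, Measure.restrict_apply hA, inter_eq_left.2 hAc,
    show A ∩ Sᶜ = ∅ from by rwa [← sdiff_eq, sdiff_eq_empty]]
  simp

/-- The density is continuous, hence bounded on a compact coordinate neighbourhood. Local finiteness
makes continuous functions of compact support integrable. -/
instance isLocallyFiniteMeasure_riemannianVolume (g : Metric m M) :
    IsLocallyFiniteMeasure (riemannianVolume g) := by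
  refine ⟨fun x => ?_⟩
  obtain ⟨K, hK, hKx, hKt⟩ := exists_compact_subset (isOpen_extChartAt_target (I := 𝓡 m) x)
    (mem_extChartAt_target (I := 𝓡 m) x)
  have hU : IsOpen ((extChartAt (𝓡 m) x).source ∩ extChartAt (𝓡 m) x ⁻¹' interior K) :=
    (continuousOn_extChartAt x).isOpen_inter_preimage (isOpen_extChartAt_source x) isOpen_interior
  refine ⟨_, hU.mem_nhds ⟨mem_extChartAt_source x, hKx⟩, ?_⟩
  refine (riemannianVolume_le g x hU.measurableSet inter_subset_left).trans_lt ?_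
  rw [chartVolume_apply g x hU.measurableSet]
  obtain ⟨C, hC⟩ := hK.exists_bound_of_continuousOn (f := coordDensity g x)
    fun z hz => (continuousAt_coordDensity g x (hKt hz)).continuousWithinAt
  calc _ ≤ ∫⁻ y in K, ENNReal.ofReal (coordDensity g x y) := by
        refine lintegral_mono_set fun z hz => ?_
        have := hz.1.2
        rw [mem_preimage, (extChartAt (𝓡 m) x).right_inv hz.2] at this
        exact interior_subset this
    _ ≤ ∫⁻ y in K, ENNReal.ofReal C := by
        refine setLIntegral_mono' hK.measurableSet fun z hz => ENNReal.ofReal_le_ofReal ?_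
        exact (le_abs_self _).trans (hC z hz)
    _ < ⊤ := by
        rw [setLIntegral_const]
        exact ENNReal.mul_lt_top ENNReal.ofReal_lt_top hK.measure_lt_top

end Volume

/-! ### Differentiation under the integral for variations of compact support. -/

section ParametricIntegral

variable {P : Type*} [NormedAddCommGroup P] [NormedSpace ℝ P] {m : ℕ}
  {M : Type*} [TopologicalSpace M] [ChartedSpace (Model m) M] [IsManifold (𝓡 m) ∞ M]

/-- The derivative of a family of functions in the direction `v` of the parameter space. -/
def paramDeriv (v : P) (f : P → M → ℝ) : P → M → ℝ := fun p x => fderiv ℝ (fun q => f q x) p v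

theorem contDiffAt_slice {f : P → M → ℝ} {p : P} {x : M}
    (hf : ContMDiffAt (𝓘(ℝ, P).prod (𝓡 m)) 𝓘(ℝ, ℝ) ∞ (fun q : P × M => f q.1 q.2) (p, x)) :
    ContDiffAt ℝ ∞ (fun q => f q x) p :=
  contMDiffAt_iff_contDiffAt.1 (ContMDiffAt.comp (g := fun q : P × M => f q.1 q.2)
    (f := fun q : P => (q, x)) p hf (contMDiffAt_id.prodMk contMDiffAt_const))

theorem contMDiffAt_paramDeriv (v : P) {f : P → M → ℝ} {q : P × M}
    (hf : ContMDiffAt (𝓘(ℝ, P).prod (𝓡 m)) 𝓘(ℝ, ℝ) ∞ (fun q : P × M => f q.1 q.2) q) :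
    ContMDiffAt (𝓘(ℝ, P).prod (𝓡 m)) 𝓘(ℝ, ℝ) ∞ (fun q : P × M => paramDeriv v f q.1 q.2) q := by
  -- The parameter is doubled: one copy is differentiated, the other only marks where the derivative
  -- is taken.
  have h1 : ContMDiffAt ((𝓘(ℝ, P).prod (𝓡 m)).prod 𝓘(ℝ, P)) 𝓘(ℝ, ℝ) ∞
      (Function.uncurry fun (q : P × M) (p : P) => f p q.2) (q, q.1) :=
    ContMDiffAt.comp (g := fun q : P × M => f q.1 q.2) (f := fun r : (P × M) × P => (r.2, r.1.2))
      (q, q.1) hf (contMDiffAt_snd.prodMk (contMDiffAt_snd.comp _ contMDiffAt_fst))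
  have h2 := ContMDiffAt.mfderiv (m := ∞) (fun (q : P × M) (p : P) => f p q.2) Prod.fst h1
    contMDiffAt_fst (by simp)
  simp only [mfderiv_eq_fderiv] at h2
  have h3 : ContMDiffAt (𝓘(ℝ, P).prod (𝓡 m)) 𝓘(ℝ, P →L[ℝ] ℝ) ∞
      (fun q : P × M => fderiv ℝ (fun p => f p q.2) q.1) q :=
    (congrArg (fun F => ContMDiffAt (𝓘(ℝ, P).prod (𝓡 m)) 𝓘(ℝ, P →L[ℝ] ℝ) ∞ F q)
      (inTangentCoordinates_model_space (I := 𝓘(ℝ, P)) (I' := 𝓘(ℝ, ℝ)) Prod.fst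
        (fun q : P × M => f q.1 q.2) (fun q : P × M => fderiv ℝ (fun p => f p q.2) q.1) q)).mp h2
  exact h3.clm_apply contMDiffAt_const

theorem paramDeriv_eq_zero {f : P → M → ℝ} {p : P} {x : M} {c : ℝ} (v : P)
    (hf : ∀ᶠ q in 𝓝 p, f q x = c) : paramDeriv v f p x = 0 := by
  have : (fun q => f q x) =ᶠ[𝓝 p] fun _ => c := hf
  rw [paramDeriv, this.fderiv_eq]
  simp

theorem paramDeriv_comm (v w : P) {f : P → M → ℝ} {p : P} {x : M}
    (hf : ContDiffAt ℝ ∞ (fun q => f q x) p) :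
    paramDeriv v (paramDeriv w f) p x = paramDeriv w (paramDeriv v f) p x := by
  have hd : HasFDerivAt (fderiv ℝ fun q => f q x) (fderiv ℝ (fderiv ℝ fun q => f q x) p) p :=
    ((hf.fderiv_right (m := 1) (by norm_cast)).differentiableAt (by simp)).hasFDerivAt
  have h1 : ∀ v w : P, paramDeriv v (paramDeriv w f) p x =
      fderiv ℝ (fderiv ℝ fun q => f q x) p v w := by
    intro v w
    have : HasFDerivAt (fun q => fderiv ℝ (fun q => f q x) q w)
        ((fderiv ℝ (fderiv ℝ fun q => f q x) p).flip w) p := by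
      simpa using hd.clm_apply (hasFDerivAt_const w p)
    exact DFunLike.congr_fun this.fderiv v
  rw [h1, h1]
  exact ((hf.of_le (n := ∞) (m := 2) (by norm_cast)).isSymmSndFDerivAt (by simp)) v w

theorem continuous_slice {f : P → M → ℝ}
    (hf : ContMDiff (𝓘(ℝ, P).prod (𝓡 m)) 𝓘(ℝ, ℝ) ∞ (fun q : P × M => f q.1 q.2)) (p : P) :
    Continuous (f p) :=
  hf.continuous.comp (Continuous.prodMk_right p)

variable [MeasurableSpace M] [BorelSpace M] [T2Space M]

/-- A smooth family of integrable functions that is constant off a compact set, locally in the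
parameter. -/
structure IsCompactVariation (f : P → M → ℝ) (μ : Measure M) : Prop where
  smooth : ContMDiff (𝓘(ℝ, P).prod (𝓡 m)) 𝓘(ℝ, ℝ) ∞ (fun q : P × M => f q.1 q.2)
  compactSupport : ∀ p₀ : P, ∃ K : Set M, IsCompact K ∧
    ∀ᶠ p in 𝓝 p₀, ∀ x, x ∉ K → f p x = f p₀ x
  integrable : ∀ p, Integrable (f p) μ

/-- Off a compact set the family is locally constant in the parameter, so its derivative vanishes
there. Closure under differentiation is what allows second derivatives under the integral. -/
theorem IsCompactVariation.paramDeriv {f : P → M → ℝ} {μ : Measure M} [IsLocallyFiniteMeasure μ]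
    (hf : IsCompactVariation (m := m) f μ) (v : P) :
    IsCompactVariation (m := m) (paramDeriv v f) μ := by
  have hsm : ContMDiff (𝓘(ℝ, P).prod (𝓡 m)) 𝓘(ℝ, ℝ) ∞
      (fun q : P × M => RestrictedHarmonic.paramDeriv v f q.1 q.2) :=
    fun q => contMDiffAt_paramDeriv v (hf.smooth q)
  have hz : ∀ p₀ : P, ∃ K : Set M, IsCompact K ∧
      ∀ᶠ p in 𝓝 p₀, ∀ x, x ∉ K → RestrictedHarmonic.paramDeriv v f p x = 0 := by
    intro p₀
    obtain ⟨K, hK, h⟩ := hf.compactSupport p₀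
    refine ⟨K, hK, ?_⟩
    filter_upwards [eventually_eventually_nhds.2 h] with p hp x hx
    exact paramDeriv_eq_zero v (hp.mono fun q hq => hq x hx)
  refine ⟨hsm, fun p₀ => ?_, fun p => ?_⟩
  · obtain ⟨K, hK, h⟩ := hz p₀
    refine ⟨K, hK, h.mono fun p hp x hx => ?_⟩
    rw [hp x hx, h.self_of_nhds x hx]
  · obtain ⟨K, hK, h⟩ := hz p
    exact (continuous_slice hsm p).integrable_of_hasCompactSupport
      (HasCompactSupport.intro hK h.self_of_nhds)

theorem IsCompactVariation.hasDerivAt_integral {f : P → M → ℝ} {μ : Measure M}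
    [IsLocallyFiniteMeasure μ] (hf : IsCompactVariation (m := m) f μ) (p v : P) :
    HasDerivAt (fun r : ℝ => ∫ x, f (p + r • v) x ∂μ)
      (∫ x, RestrictedHarmonic.paramDeriv v f p x ∂μ) 0 := by
  obtain ⟨K, hK, h⟩ := hf.compactSupport p
  set f' := RestrictedHarmonic.paramDeriv v f
  have hsm : ContMDiff (𝓘(ℝ, P).prod (𝓡 m)) 𝓘(ℝ, ℝ) ∞ (fun q : P × M => f' q.1 q.2) :=
    fun q => contMDiffAt_paramDeriv v (hf.smooth q)
  obtain ⟨C, hC⟩ := hK.exists_bound_of_continuousOn (continuous_slice hsm p).continuousOn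
  have hO : IsOpen {q : P × M | ‖f' q.1 q.2‖ < C + 1} :=
    isOpen_lt hsm.continuous.norm continuous_const
  -- The derivative is bounded by `C` on `K` at the parameter `p`; the tube lemma extends the bound
  -- `C + 1` to all of `K` for nearby parameters. Off `K` the derivative is zero, so `C + 1` on `K`
  -- is an integrable majorant.
  obtain ⟨U, W, hU, -, hpU, hKW, hUW⟩ := generalized_tube_lemma (isCompact_singleton (x := p)) hK hO
    (by
      rintro ⟨q, x⟩ ⟨hq, hx⟩
      rw [mem_singleton_iff] at hq
      subst hq
      exact (hC x hx).trans_lt (lt_add_one C))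
  have hpt : Tendsto (fun r : ℝ => p + r • v) (𝓝 0) (𝓝 p) := by
    have : Continuous fun r : ℝ => p + r • v := by fun_prop
    simpa using this.tendsto 0
  have hs : ∀ᶠ q in 𝓝 p, q ∈ U ∧ ∀ x, x ∉ K → f' q x = 0 := by
    filter_upwards [hU.mem_nhds (hpU rfl), eventually_eventually_nhds.2 h] with q hq hq'
    exact ⟨hq, fun x hx => paramDeriv_eq_zero v (hq'.mono fun q hq => hq x hx)⟩
  have hmain := hasDerivAt_integral_of_dominated_loc_of_deriv_le (μ := μ)
    (F := fun (r : ℝ) x => f (p + r • v) x) (F' := fun r x => f' (p + r • v) x)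
    (bound := K.indicator fun _ => C + 1) (hpt.eventually hs)
    (Eventually.of_forall fun r => (continuous_slice hf.smooth _).aestronglyMeasurable)
    (by simpa using hf.integrable p)
    (continuous_slice hsm _).aestronglyMeasurable
    (Eventually.of_forall fun x r hr => ?_)
    ((integrable_indicator_iff hK.measurableSet).2
      (integrableOn_const (by exact hK.measure_lt_top.ne)))
    (Eventually.of_forall fun x r _ => ?_)
  · simpa using hmain.2
  · by_cases hx : x ∈ K
    · rw [indicator_of_mem hx]
      exact (hUW (mk_mem_prod hr.1 (hKW hx))).le
    · rw [indicator_of_notMem hx, hr.2 x hx, norm_zero]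
  · have h1 : HasFDerivAt (fun q => f q x) (fderiv ℝ (fun q => f q x) (p + r • v)) (p + r • v) :=
      ((contDiffAt_slice (hf.smooth (p + r • v, x))).differentiableAt (by simp)).hasFDerivAt
    have h2 : HasDerivAt (fun r : ℝ => p + r • v) v r := by
      simpa using ((hasDerivAt_id r).smul_const v).const_add p
    exact h1.comp_hasDerivAt r h2

end ParametricIntegral

/-! ### The pointwise second variation of the energy density. -/

section SecondVariation

variable {m n : ℕ}
  {M : Type*} [TopologicalSpace M] [ChartedSpace (Model m) M] [IsManifold (𝓡 m) ∞ M]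
  {N : Type*} [TopologicalSpace N] [ChartedSpace (Model n) N] [IsManifold (𝓡 n) ∞ N]

/-- The factors `b i` depend on the second parameter alone, so `∂_s` falls only on `a i`, and `∂_t`
then gives two terms. -/
theorem mixed_fderiv_sum {ι : Type*} [Fintype ι] {a : ι → ℝ × ℝ → ℝ} {b : ι → ℝ → ℝ}
    (ha : ∀ i, ContDiffAt ℝ 2 (a i) 0) (hb : ∀ i, ContDiffAt ℝ 1 (b i) 0) :
    fderiv ℝ (fun p => fderiv ℝ (fun q : ℝ × ℝ => ∑ i, b i q.2 * a i q) p (1, 0)) 0 (0, 1) =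
      ∑ i, (deriv (b i) 0 * fderiv ℝ (a i) 0 (1, 0) +
        b i 0 * fderiv ℝ (fun p => fderiv ℝ (a i) p (1, 0)) 0 (0, 1)) := by
  have hb2 : ∀ {i} {p : ℝ × ℝ}, DifferentiableAt ℝ (b i) p.2 →
      HasFDerivAt (fun q : ℝ × ℝ => b i q.2)
        ((deriv (b i) p.2) • ContinuousLinearMap.snd ℝ ℝ ℝ) p := fun {i p} h => by
    exact h.hasDerivAt.comp_hasFDerivAt p hasFDerivAt_snd
  have h1 : (fun p => fderiv ℝ (fun q : ℝ × ℝ => ∑ i, b i q.2 * a i q) p (1, 0)) =ᶠ[𝓝 0]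
      fun p => ∑ i, b i p.2 * fderiv ℝ (a i) p (1, 0) := by
    have hda : ∀ᶠ p in 𝓝 (0 : ℝ × ℝ), ∀ i, DifferentiableAt ℝ (a i) p :=
      eventually_all.2 fun i => ((ha i).eventually (by simp)).mono fun p hp =>
        hp.differentiableAt (by simp)
    have hdb : ∀ᶠ p in 𝓝 (0 : ℝ × ℝ), ∀ i, DifferentiableAt ℝ (b i) p.2 :=
      (continuous_snd.tendsto (0 : ℝ × ℝ)).eventually (eventually_all.2 fun i =>
        ((hb i).eventually (by simp)).mono fun p hp => hp.differentiableAt (by simp))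
    filter_upwards [hda, hdb] with p hpa hpb
    have := HasFDerivAt.fun_sum (u := Finset.univ)
      fun i _ => (hb2 (hpb i)).fun_mul (hpa i).hasFDerivAt
    rw [this.fderiv]
    simp
  rw [h1.fderiv_eq]
  have h2 : ∀ i, HasFDerivAt (fun p => fderiv ℝ (a i) p (1, 0))
      (fderiv ℝ (fun p => fderiv ℝ (a i) p (1, 0)) 0) (0 : ℝ × ℝ) := fun i =>
    ((((ha i).fderiv_right (m := 1) (by norm_num)).differentiableAt (by simp)).clm_apply
      (differentiableAt_const _)).hasFDerivAt
  have h3 := HasFDerivAt.fun_sum (u := Finset.univ) fun i _ =>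
    (hb2 (p := (0 : ℝ × ℝ)) ((hb i).differentiableAt (by simp))).fun_mul (h2 i)
  rw [h3.fderiv]
  simp only [sum_apply, add_apply, smul_apply, smul_eq_mul,
    Prod.snd_zero, ContinuousLinearMap.coe_snd']
  exact Finset.sum_congr rfl fun i _ => by ring

/-- Differentiate `A * A⁻¹ = 1`, which holds near `0` because the determinant stays nonzero. -/
theorem deriv_matrix_inv {A : ℝ → Matrix (Fin m) (Fin m) ℝ} {A' : Matrix (Fin m) (Fin m) ℝ}
    (hA : ∀ i j, HasDerivAt (fun t => A t i j) (A' i j) 0) (h0 : (A 0).det ≠ 0)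
    (hinv : ∀ i j, DifferentiableAt ℝ (fun t => (A t)⁻¹ i j) 0) :
    (Matrix.of fun i j => deriv (fun t => (A t)⁻¹ i j) 0) = -((A 0)⁻¹ * A' * (A 0)⁻¹) := by
  set K' : Matrix (Fin m) (Fin m) ℝ := Matrix.of fun i j => deriv (fun t => (A t)⁻¹ i j) 0
  have hu : IsUnit (A 0).det := isUnit_iff_ne_zero.2 h0
  have hdet : ContinuousAt (fun t => (A t).det) 0 := by
    simp only [Matrix.det_apply']
    exact tendsto_finsetSum _ fun σ _ => tendsto_const_nhds.mul
      (tendsto_finsetProd _ fun i _ => (hA _ _).continuousAt)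
  have h1 : A' * (A 0)⁻¹ + A 0 * K' = 0 := by
    ext i j
    have hs : HasDerivAt (fun t => ∑ k, A t i k * (A t)⁻¹ k j)
        (∑ k, (A' i k * (A 0)⁻¹ k j + A 0 i k * K' k j)) 0 :=
      HasDerivAt.fun_sum fun k _ => (hA i k).mul (hinv k j).hasDerivAt
    have hc : (fun t => ∑ k, A t i k * (A t)⁻¹ k j) =ᶠ[𝓝 0]
        fun _ => (1 : Matrix (Fin m) (Fin m) ℝ) i j := by
      filter_upwards [hdet.eventually_ne h0] with t ht
      rw [← Matrix.mul_nonsing_inv (A t) (isUnit_iff_ne_zero.2 ht), Matrix.mul_apply]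
    have := (hs.congr_of_eventuallyEq hc.symm).unique (hasDerivAt_const _ _)
    rw [Finset.sum_add_distrib] at this
    simpa [Matrix.mul_apply] using this
  have h2 : A 0 * K' = -(A' * (A 0)⁻¹) := by
    rw [eq_neg_iff_add_eq_zero, add_comm, h1]
  calc K' = (A 0)⁻¹ * (A 0 * K') := by rw [← Matrix.mul_assoc, Matrix.nonsing_inv_mul _ hu,
        Matrix.one_mul]
    _ = _ := by rw [h2, Matrix.mul_neg, Matrix.mul_assoc]

/-- A two-parameter family of maps, defined and smooth near `((0, 0), x)`, that passes through the
identity with velocities `X` and `Y`. -/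
structure IsLocalVariation (X Y : VField m M) (ψ : ℝ × ℝ → M → M) (x : M) : Prop where
  smooth : ∀ᶠ q in 𝓝 ((0 : ℝ × ℝ), x),
    ContMDiffAt (𝓘(ℝ, ℝ × ℝ).prod (𝓡 m)) (𝓡 m) ∞ (fun q : (ℝ × ℝ) × M => ψ q.1 q.2) q
  base : ∀ᶠ x' in 𝓝 x, ψ (0, 0) x' = x'
  tangent_left : ∀ᶠ x' in 𝓝 x, (⟨ψ (0, 0) x',
    mfderiv 𝓘(ℝ, ℝ) (𝓡 m) (fun s : ℝ => ψ (s, 0) x') 0 (1 : ℝ)⟩ : TangentBundle (𝓡 m) M)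
      = ⟨x', X x'⟩
  tangent_right : ∀ᶠ x' in 𝓝 x, (⟨ψ (0, 0) x',
    mfderiv 𝓘(ℝ, ℝ) (𝓡 m) (fun t : ℝ => ψ (0, t) x') 0 (1 : ℝ)⟩ : TangentBundle (𝓡 m) M)
      = ⟨x', Y x'⟩

/-- The energy density of `φ ∘ ψ p`. -/
def densityFamily (g : Metric m M) (h : Metric n N) (φ : M → N) (ψ : ℝ × ℝ → M → M) :
    ℝ × ℝ → M → ℝ := fun p x =>
  relTrace (m := m) (pullbackMetric (fun x : M => x) g) (pullbackMetric (φ ∘ ψ p) h) x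

/-- The energy density of `φ ∘ ψ p` with respect to the metric `ψ (0, t)^* g`, for `p = (s, t)`. -/
def movingDensityFamily (g : Metric m M) (h : Metric n N) (φ : M → N) (ψ : ℝ × ℝ → M → M) :
    ℝ × ℝ → M → ℝ := fun p x =>
  relTrace (m := m) (pullbackMetric (ψ (0, p.2)) g) (pullbackMetric (φ ∘ ψ p) h) x

theorem IsLocalVariation.eventually {X Y : VField m M} {ψ : ℝ × ℝ → M → M} {x : M}
    (hψ : IsLocalVariation X Y ψ x) : ∀ᶠ x' in 𝓝 x, IsLocalVariation X Y ψ x' := by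
  have h1 := ((Continuous.prodMk_right (0 : ℝ × ℝ)).tendsto x).eventually
    (eventually_eventually_nhds.2 hψ.smooth)
  filter_upwards [h1, eventually_eventually_nhds.2 hψ.base,
    eventually_eventually_nhds.2 hψ.tangent_left,
    eventually_eventually_nhds.2 hψ.tangent_right] with x' a b c d
  exact ⟨a, b, c, d⟩

theorem contMDiffAt_densityFamily (g : Metric m M) (h : Metric n N) {φ : M → N}
    (hφ : ContMDiff (𝓡 m) (𝓡 n) ∞ φ) {ψ : ℝ × ℝ → M → M} {p : ℝ × ℝ} {x : M}
    (hψ : ∀ᶠ q in 𝓝 (p, x), ContMDiffAt (𝓘(ℝ, ℝ × ℝ).prod (𝓡 m)) (𝓡 m) ∞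
      (fun q : (ℝ × ℝ) × M => ψ q.1 q.2) q) :
    ContMDiffAt (𝓘(ℝ, ℝ × ℝ).prod (𝓡 m)) 𝓘(ℝ, ℝ) ∞
      (fun q : (ℝ × ℝ) × M => densityFamily g h φ ψ q.1 q.2) (p, x) := by
  refine contMDiffAt_relTrace g h (χ := fun _ x => x) (ψ := fun p => φ ∘ ψ p)
    (Eventually.of_forall fun q => contMDiffAt_snd) (hψ.mono fun q hq => (hφ _).comp q hq) ?_
  have : mfderiv (𝓡 m) (𝓡 m) (fun x : M => x) x = ContinuousLinearMap.id ℝ _ := mfderiv_id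
  rw [this]
  exact Function.injective_id

theorem contMDiffAt_movingDensityFamily (g : Metric m M) (h : Metric n N) {φ : M → N}
    (hφ : ContMDiff (𝓡 m) (𝓡 n) ∞ φ) {ψ : ℝ × ℝ → M → M} {p : ℝ × ℝ} {x : M}
    (hψ : ∀ᶠ q in 𝓝 (p, x), ContMDiffAt (𝓘(ℝ, ℝ × ℝ).prod (𝓡 m)) (𝓡 m) ∞
      (fun q : (ℝ × ℝ) × M => ψ q.1 q.2) q)
    (hψ0 : ∀ᶠ q in 𝓝 ((0, p.2), x), ContMDiffAt (𝓘(ℝ, ℝ × ℝ).prod (𝓡 m)) (𝓡 m) ∞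
      (fun q : (ℝ × ℝ) × M => ψ q.1 q.2) q)
    (hinj : Function.Injective (mfderiv (𝓡 m) (𝓡 m) (ψ (0, p.2)) x)) :
    ContMDiffAt (𝓘(ℝ, ℝ × ℝ).prod (𝓡 m)) 𝓘(ℝ, ℝ) ∞
      (fun q : (ℝ × ℝ) × M => movingDensityFamily g h φ ψ q.1 q.2) (p, x) := by
  have hc : Continuous fun q : (ℝ × ℝ) × M => (((0 : ℝ), q.1.2), q.2) := by fun_prop
  have hχ : ∀ᶠ q in 𝓝 (p, x), ContMDiffAt (𝓘(ℝ, ℝ × ℝ).prod (𝓡 m)) (𝓡 m) ∞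
      (fun q : (ℝ × ℝ) × M => ψ (0, q.1.2) q.2) q := by
    filter_upwards [(hc.tendsto (p, x)).eventually hψ0] with q hq
    have hl : ContMDiff 𝓘(ℝ, ℝ × ℝ) 𝓘(ℝ, ℝ × ℝ) ∞ fun p : ℝ × ℝ => ((0 : ℝ), p.2) :=
      (contDiff_const.prodMk contDiff_snd).contMDiff
    exact ContMDiffAt.comp (g := fun q : (ℝ × ℝ) × M => ψ q.1 q.2)
      (f := fun q : (ℝ × ℝ) × M => (((0 : ℝ), q.1.2), q.2)) q hq
      (((hl _).comp q contMDiffAt_fst).prodMk contMDiffAt_snd)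
  have hφψ : ∀ᶠ q in 𝓝 (p, x), ContMDiffAt (𝓘(ℝ, ℝ × ℝ).prod (𝓡 m)) (𝓡 n) ∞
      (fun q : (ℝ × ℝ) × M => (φ ∘ ψ q.1) q.2) q := hψ.mono fun q hq => (hφ _).comp q hq
  have key := contMDiffAt_relTrace g h (χ := fun p : ℝ × ℝ => ψ (0, p.2))
    (ψ := fun p => φ ∘ ψ p) hχ hφψ hinj
  unfold movingDensityFamily
  exact key

theorem injective_mfderiv_of_eventually_eq_id {χ : M → M} {x : M} (h : ∀ᶠ x' in 𝓝 x, χ x' = x') :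
    Function.Injective (mfderiv (𝓡 m) (𝓡 m) χ x) := by
  have h1 : χ =ᶠ[𝓝 x] id := h
  rw [h1.mfderiv_eq, mfderiv_id]
  exact Function.injective_id

theorem hasDerivAt_pullback_left {X Y : VField m M} {ψ : ℝ × ℝ → M → M} {x : M}
    (hψ : IsLocalVariation X Y ψ x) (h : Metric n N) {φ : M → N}
    (hφ : ContMDiff (𝓡 m) (𝓡 n) ∞ φ) (u v : TangentSpace (𝓡 m) x) :
    HasDerivAt (fun s => pullbackMetric (m := m) (φ ∘ ψ (s, 0)) h x u v)
      (lieDerivative X (pullbackMetric φ h) x u v) 0 := by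
  refine hasDerivAt_pullbackMetric_family X h (ψ := fun s => ψ (s, 0))
    (Eventually.of_forall hφ) ?_ hψ.base hψ.tangent_left u v
  have hc : Continuous fun q : ℝ × M => ((q.1, (0 : ℝ)), q.2) := by fun_prop
  filter_upwards [(hc.tendsto ((0 : ℝ), x)).eventually hψ.smooth] with q hq
  exact ContMDiffAt.comp (g := fun q : (ℝ × ℝ) × M => ψ q.1 q.2)
    (f := fun q : ℝ × M => ((q.1, (0 : ℝ)), q.2)) q hq
    ((contMDiffAt_fst.prodMk_space contMDiffAt_const).prodMk contMDiffAt_snd)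

/-- Lets the result on the first parameter, `hasDerivAt_pullback_left`, be used for the second. -/
theorem IsLocalVariation.swap {X Y : VField m M} {ψ : ℝ × ℝ → M → M} {x : M}
    (hψ : IsLocalVariation X Y ψ x) : IsLocalVariation Y X (fun p => ψ p.swap) x := by
  refine ⟨?_, hψ.base, hψ.tangent_right, hψ.tangent_left⟩
  have hc : Continuous fun q : (ℝ × ℝ) × M => (q.1.swap, q.2) := by fun_prop
  filter_upwards [(hc.tendsto ((0 : ℝ × ℝ), x)).eventually hψ.smooth] with q hq
  have hl : ContMDiff 𝓘(ℝ, ℝ × ℝ) 𝓘(ℝ, ℝ × ℝ) ∞ fun p : ℝ × ℝ => p.swap :=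
    (contDiff_snd.prodMk contDiff_fst).contMDiff
  exact ContMDiffAt.comp (g := fun q : (ℝ × ℝ) × M => ψ q.1 q.2)
    (f := fun q : (ℝ × ℝ) × M => (q.1.swap, q.2)) q hq
    (((hl _).comp q contMDiffAt_fst).prodMk contMDiffAt_snd)

theorem pullbackMetric_symm (h : Metric n N) (φ : M → N) (x : M) (u v : TangentSpace (𝓡 m) x) :
    pullbackMetric (m := m) φ h x u v = pullbackMetric φ h x v u :=
  h.symm _ _ _

/-- Both densities are traces against the same matrix `A`; only the inverse metric differs, frozen
in one and moving in the other. They agree at `t = 0`, so the terms in the mixed derivative of `A`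
cancel and just the derivative of the moving inverse survives. This is local and uses neither volume
preservation nor harmonicity. -/
theorem mixed_paramDeriv_density_sub {X Y : VField m M} {ψ : ℝ × ℝ → M → M} {x : M}
    (hψ : IsLocalVariation X Y ψ x) (g : Metric m M) (h : Metric n N) {φ : M → N}
    (hφ : ContMDiff (𝓡 m) (𝓡 n) ∞ φ) :
    paramDeriv (0, 1) (paramDeriv (1, 0) (densityFamily g h φ ψ)) 0 x -
        paramDeriv (0, 1) (paramDeriv (1, 0) (movingDensityFamily g h φ ψ)) 0 x =
      tensorInner g (lieDerivative X (pullbackMetric φ h)) (lieDerivative Y g.tensor) x := by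
  set A : ℝ × ℝ → Matrix (Fin m) (Fin m) ℝ := fun p =>
    tensorMatrix (m := m) (pullbackMetric (φ ∘ ψ p) h) x with hA
  set G : ℝ → Matrix (Fin m) (Fin m) ℝ := fun t =>
    tensorMatrix (m := m) (pullbackMetric (ψ (0, t)) g) x with hG
  have hG0 : G 0 = tensorMatrix g.tensor x := by
    rw [← pullbackMetric_id g]
    exact tensorMatrix_congr (pullbackMetric_congr g hψ.base)
  have hGdet : (G 0).det ≠ 0 :=
    (tensorMatrix_pullbackMetric_posDef g
      (injective_mfderiv_of_eventually_eq_id hψ.base)).det_pos.ne'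
  have hAs : ∀ i j, ContDiffAt ℝ ∞ (fun p => A p i j) 0 := fun i j =>
    contDiffAt_pullbackMetric_param h (ψ := fun p => φ ∘ ψ p)
      (hψ.smooth.mono fun q hq => (hφ _).comp q hq) _ _
  have hGs : ∀ i j, ContDiffAt ℝ ∞ (fun t => G t i j) 0 := fun i j =>
    (ContDiffAt.comp (g := fun p => pullbackMetric (m := m) (ψ p) g x
      (stdVec i : Model m) (stdVec j : Model m)) (f := fun t : ℝ => ((0 : ℝ), t)) (0 : ℝ)
      (contDiffAt_pullbackMetric_param g (ψ := ψ) hψ.smooth _ _)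
      (contDiff_prodMk_right (0 : ℝ)).contDiffAt :)
  have hGi := fun i j => contDiffAt_matrix_inv hGs hGdet i j
  have hA' : ∀ i j, fderiv ℝ (fun p => A p i j) 0 (1, 0) =
      tensorMatrix (lieDerivative X (pullbackMetric φ h)) x i j := fun i j => by
    have h1 := hasDerivAt_pullback_left hψ h hφ (stdVec i : Model m) (stdVec j : Model m)
    have h2 : HasDerivAt (fun s : ℝ => A (s, 0) i j) (fderiv ℝ (fun p => A p i j) 0 (1, 0)) 0 :=
      HasFDerivAt.comp_hasDerivAt (f := fun s : ℝ => (s, (0 : ℝ))) (0 : ℝ)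
        ((hAs i j).differentiableAt (by simp)).hasFDerivAt
        ((hasDerivAt_id (0 : ℝ)).prodMk (hasDerivAt_const _ _))
    exact h2.unique h1
  have hG' : ∀ i j, HasDerivAt (fun t => G t i j)
      (tensorMatrix (lieDerivative Y g.tensor) x i j) 0 := fun i j => by
    rw [← pullbackMetric_id g]
    exact hasDerivAt_pullback_left hψ.swap g (φ := fun x : M => x) contMDiff_id _ _
  -- Symmetry of `L_Y g`, inherited from the pullbacks of `g`, absorbs the transpose in the
  -- definition of the inner product.
  have hβ : (tensorMatrix (lieDerivative Y g.tensor) x).transpose =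
      tensorMatrix (lieDerivative Y g.tensor) x := by
    ext i j
    have : (fun t => G t j i) = fun t => G t i j := funext fun t => pullbackMetric_symm g _ x _ _
    have h1 := hG' j i
    rw [this] at h1
    exact h1.unique (hG' i j)
  have hinv := deriv_matrix_inv hG' hGdet fun i j => (hGi i j).differentiableAt (by simp)
  have hf1 : ∀ p, densityFamily g h φ ψ p x =
      ∑ q : Fin m × Fin m, (fun _ : ℝ => (G 0)⁻¹ q.1 q.2) p.2 * A p q.2 q.1 := fun p => by
    rw [densityFamily, relTrace, pullbackMetric_id, ← hG0, Fintype.sum_prod_type]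
    rfl
  have hf2 : ∀ p, movingDensityFamily g h φ ψ p x =
      ∑ q : Fin m × Fin m, (G p.2)⁻¹ q.1 q.2 * A p q.2 q.1 := fun p => by
    rw [movingDensityFamily, relTrace, Fintype.sum_prod_type]
    rfl
  simp only [paramDeriv, hf1, hf2]
  have hA2 : ∀ q : Fin m × Fin m, ContDiffAt ℝ 2 (fun p => A p q.2 q.1) 0 := fun q =>
    (hAs _ _).of_le (by norm_cast)
  rw [mixed_fderiv_sum (ι := Fin m × Fin m) (a := fun q p => A p q.2 q.1)
      (b := fun q _ => (G 0)⁻¹ q.1 q.2) hA2 (fun q => contDiffAt_const),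
    mixed_fderiv_sum (ι := Fin m × Fin m) (a := fun q p => A p q.2 q.1)
      (b := fun q t => (G t)⁻¹ q.1 q.2) hA2 (fun q => (hGi _ _).of_le (by norm_cast)),
    ← Finset.sum_sub_distrib]
  have hsum : ∀ q : Fin m × Fin m, (deriv (fun _ : ℝ => (G 0)⁻¹ q.1 q.2) 0 *
        fderiv ℝ (fun p => A p q.2 q.1) 0 (1, 0) + (G 0)⁻¹ q.1 q.2 *
          fderiv ℝ (fun p => fderiv ℝ (fun p => A p q.2 q.1) p (1, 0)) 0 (0, 1)) -
      (deriv (fun t : ℝ => (G t)⁻¹ q.1 q.2) 0 *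
        fderiv ℝ (fun p => A p q.2 q.1) 0 (1, 0) + (G 0)⁻¹ q.1 q.2 *
          fderiv ℝ (fun p => fderiv ℝ (fun p => A p q.2 q.1) p (1, 0)) 0 (0, 1)) =
      ((G 0)⁻¹ * tensorMatrix (lieDerivative Y g.tensor) x * (G 0)⁻¹) q.1 q.2 *
        tensorMatrix (lieDerivative X (pullbackMetric φ h)) x q.2 q.1 := fun q => by
    have h1 : deriv (fun t : ℝ => (G t)⁻¹ q.1 q.2) 0 =
        -((G 0)⁻¹ * tensorMatrix (lieDerivative Y g.tensor) x * (G 0)⁻¹) q.1 q.2 :=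
      congrFun (congrFun hinv q.1) q.2
    rw [h1, hA', deriv_const]
    ring
  rw [Finset.sum_congr rfl fun q _ => hsum q, Fintype.sum_prod_type]
  rw [tensorInner, hβ, ← hG0]
  rw [Matrix.mul_assoc ((G 0)⁻¹ * _), Matrix.trace_mul_comm, ← Matrix.mul_assoc]
  simp only [Matrix.trace, Matrix.diag_apply]
  exact Finset.sum_congr rfl fun i _ => (Matrix.mul_apply).symm

end SecondVariation

/-! ### Continuity and compact support of the integrand. -/

section Integrability

variable {m n : ℕ}
  {M : Type*} [TopologicalSpace M] [ChartedSpace (Model m) M] [IsManifold (𝓡 m) ∞ M]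
  {N : Type*} [TopologicalSpace N] [ChartedSpace (Model n) N] [IsManifold (𝓡 n) ∞ N]

theorem contDiffAt_coordField {X : VField m M}
    (hX : ContMDiff (𝓡 m) (𝓡 m).tangent ∞ (fun x => (⟨x, X x⟩ : TangentBundle (𝓡 m) M)))
    (c : M) {z : Model m} (hz : z ∈ (extChartAt (𝓡 m) c).target) :
    ContDiffAt ℝ ∞ (coordField X c) z := by
  have hinv : (mfderiv 𝓘(ℝ, Model m) (𝓡 m) (extChartAt (𝓡 m) c).symm z).IsInvertible := by
    have := isInvertible_mfderivWithin_extChartAt_symm (I := 𝓡 m) hz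
    rwa [ModelWithCorners.Boundaryless.range_eq_univ, mfderivWithin_univ] at this
  exact contMDiffAt_vectorSpace_iff_contDiffAt.1
    (ContMDiffAt.mpullback_vectorField_preimage (m := ∞) (n := ∞) (hX _)
      (contMDiffAt_chart_symm c hz) hinv (by simp))

theorem tangent_chart_curve (X : VField m M) {c x : M}
    (hx : x ∈ (extChartAt (𝓡 m) c).source) {γ : ℝ → Model m}
    (hγ : HasDerivAt γ (coordField X c (extChartAt (𝓡 m) c x)) 0)
    (hγ0 : γ 0 = extChartAt (𝓡 m) c x) :
    (⟨(extChartAt (𝓡 m) c).symm (γ 0), mfderiv 𝓘(ℝ, ℝ) (𝓡 m)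
      (fun s : ℝ => (extChartAt (𝓡 m) c).symm (γ s)) 0 (1 : ℝ)⟩ : TangentBundle (𝓡 m) M)
      = ⟨x, X x⟩ := by
  have hy := (extChartAt (𝓡 m) c).map_source hx
  have hxy := (extChartAt (𝓡 m) c).left_inv hx
  set y := extChartAt (𝓡 m) c x
  have hσ : MDifferentiableAt 𝓘(ℝ, Model m) (𝓡 m) (extChartAt (𝓡 m) c).symm (γ 0) :=
    (contMDiffAt_chart_symm c (hγ0 ▸ hy)).mdifferentiableAt (by simp)
  have h1 := (HasMFDerivAt.comp (0 : ℝ) hσ.hasMFDerivAt hγ.hasFDerivAt.hasMFDerivAt).mfderiv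
  have h2 : mfderiv 𝓘(ℝ, ℝ) (𝓡 m) (fun s : ℝ => (extChartAt (𝓡 m) c).symm (γ s)) 0 (1 : ℝ) =
      mfderiv 𝓘(ℝ, Model m) (𝓡 m) (extChartAt (𝓡 m) c).symm (γ 0) (coordField X c y) := by
    refine (DFunLike.congr_fun h1 (1 : ℝ)).trans ?_
    refine congrArg (mfderiv 𝓘(ℝ, Model m) (𝓡 m) (extChartAt (𝓡 m) c).symm (γ 0)) ?_
    exact one_smul ℝ (coordField X c y)
  -- Stated for a variable `z` so that `γ 0 = y` can be substituted although the type of the vector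
  -- depends on the base point; `h4` does the same for `x`.
  have h3 : ∀ z : Model m, z = y → (⟨(extChartAt (𝓡 m) c).symm z,
      mfderiv 𝓘(ℝ, Model m) (𝓡 m) (extChartAt (𝓡 m) c).symm z (coordField X c y)⟩ :
        TangentBundle (𝓡 m) M) = ⟨(extChartAt (𝓡 m) c).symm y, X ((extChartAt (𝓡 m) c).symm y)⟩ := by
    rintro z rfl
    rw [coordField_apply X c hy, mfderiv_symm_mfderiv_chart c hy]
  have h4 : ∀ x' : M, x' = x → (⟨x', X x'⟩ : TangentBundle (𝓡 m) M) = ⟨x, X x⟩ := by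
    rintro x' rfl
    rfl
  have h5 : (⟨(extChartAt (𝓡 m) c).symm (γ 0), mfderiv 𝓘(ℝ, ℝ) (𝓡 m)
      (fun s : ℝ => (extChartAt (𝓡 m) c).symm (γ s)) 0 (1 : ℝ)⟩ : TangentBundle (𝓡 m) M) =
      ⟨(extChartAt (𝓡 m) c).symm (γ 0),
        mfderiv 𝓘(ℝ, Model m) (𝓡 m) (extChartAt (𝓡 m) c).symm (γ 0) (coordField X c y)⟩ :=
    congrArg (fun v => (⟨(extChartAt (𝓡 m) c).symm (γ 0), v⟩ : TangentBundle (𝓡 m) M)) h2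
  exact h5.trans ((h3 _ hγ0).trans (h4 _ hxy))

/-- The two-parameter family that moves along straight lines in the chart around `c`. -/
def chartVariation (X Y : VField m M) (c : M) (p : ℝ × ℝ) (x : M) : M :=
  (extChartAt (𝓡 m) c).symm (extChartAt (𝓡 m) c x +
    (p.1 • coordField X c (extChartAt (𝓡 m) c x) + p.2 • coordField Y c (extChartAt (𝓡 m) c x)))

/-- Straight lines in a chart suffice here: a local variation need be neither volume preserving nor
globally defined by diffeomorphisms, so no flows have to be constructed. -/
theorem isLocalVariation_chartVariation {X Y : VField m M}
    (hX : ContMDiff (𝓡 m) (𝓡 m).tangent ∞ (fun x => (⟨x, X x⟩ : TangentBundle (𝓡 m) M)))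
    (hY : ContMDiff (𝓡 m) (𝓡 m).tangent ∞ (fun x => (⟨x, Y x⟩ : TangentBundle (𝓡 m) M)))
    (c : M) : IsLocalVariation X Y (chartVariation X Y c) c := by
  have hS : ∀ᶠ x in 𝓝 c, x ∈ (extChartAt (𝓡 m) c).source :=
    (isOpen_extChartAt_source c).mem_nhds (mem_extChartAt_source c)
  set W : (ℝ × ℝ) × M → Model m := fun q => extChartAt (𝓡 m) c q.2 +
    (q.1.1 • coordField X c (extChartAt (𝓡 m) c q.2) +
      q.1.2 • coordField Y c (extChartAt (𝓡 m) c q.2)) with hW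
  have hWs : ∀ q : (ℝ × ℝ) × M, q.2 ∈ (extChartAt (𝓡 m) c).source →
      ContMDiffAt (𝓘(ℝ, ℝ × ℝ).prod (𝓡 m)) 𝓘(ℝ, Model m) ∞ W q := fun q hq => by
    have he : ContMDiffAt (𝓘(ℝ, ℝ × ℝ).prod (𝓡 m)) 𝓘(ℝ, Model m) ∞
        (fun q : (ℝ × ℝ) × M => extChartAt (𝓡 m) c q.2) q :=
      (contMDiffAt_chart c hq).comp q contMDiffAt_snd
    have hF : ∀ {Z : VField m M},
        ContMDiff (𝓡 m) (𝓡 m).tangent ∞ (fun x => (⟨x, Z x⟩ : TangentBundle (𝓡 m) M)) →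
        ContMDiffAt (𝓘(ℝ, ℝ × ℝ).prod (𝓡 m)) 𝓘(ℝ, Model m) ∞
          (fun q : (ℝ × ℝ) × M => coordField Z c (extChartAt (𝓡 m) c q.2)) q := fun hZ =>
      (contDiffAt_coordField hZ c ((extChartAt (𝓡 m) c).map_source hq)).contMDiffAt.comp q he
    have h1 : ContMDiffAt (𝓘(ℝ, ℝ × ℝ).prod (𝓡 m)) 𝓘(ℝ, ℝ) ∞
        (fun q : (ℝ × ℝ) × M => q.1.1) q :=
      contDiff_fst.contMDiff.contMDiffAt.comp q contMDiffAt_fst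
    have h2 : ContMDiffAt (𝓘(ℝ, ℝ × ℝ).prod (𝓡 m)) 𝓘(ℝ, ℝ) ∞
        (fun q : (ℝ × ℝ) × M => q.1.2) q :=
      contDiff_snd.contMDiff.contMDiffAt.comp q contMDiffAt_fst
    exact he.add ((h1.smul (hF hX)).add (h2.smul (hF hY)))
  refine ⟨?_, ?_, ?_, ?_⟩
  · have hc := (hWs (0, c) (mem_extChartAt_source c)).continuousAt
    have hT : ∀ᶠ q in 𝓝 ((0 : ℝ × ℝ), c), W q ∈ (extChartAt (𝓡 m) c).target :=
      hc.eventually ((isOpen_extChartAt_target c).mem_nhds (by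
        simp [hW]))
    filter_upwards [(continuous_snd.tendsto ((0 : ℝ × ℝ), c)).eventually hS, hT] with q hq hq'
    exact (contMDiffAt_chart_symm c hq').comp q (hWs q hq)
  · filter_upwards [hS] with x hx
    simp only [chartVariation, zero_smul, add_zero]
    exact (extChartAt (𝓡 m) c).left_inv hx
  · filter_upwards [hS] with x hx
    refine tangent_chart_curve X hx (γ := fun s => extChartAt (𝓡 m) c x +
      (s • coordField X c (extChartAt (𝓡 m) c x) +
        (0 : ℝ) • coordField Y c (extChartAt (𝓡 m) c x))) ?_ (by simp)
    simpa using (((hasDerivAt_id (0 : ℝ)).smul_const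
      (coordField X c (extChartAt (𝓡 m) c x))).const_add (extChartAt (𝓡 m) c x))
  · filter_upwards [hS] with x hx
    refine tangent_chart_curve Y hx (γ := fun s => extChartAt (𝓡 m) c x +
      ((0 : ℝ) • coordField X c (extChartAt (𝓡 m) c x) +
        s • coordField Y c (extChartAt (𝓡 m) c x))) ?_ (by simp)
    simpa using (((hasDerivAt_id (0 : ℝ)).smul_const
      (coordField Y c (extChartAt (𝓡 m) c x))).const_add (extChartAt (𝓡 m) c x))

/-- The definition uses a different chart at each point, so continuity is not visible from it. Near
`c`, however, the function is a difference of mixed parameter derivatives of two jointly smooth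
densities, taken along one local variation. -/
theorem continuous_tensorInner_lieDerivative {X Y : VField m M}
    (hX : ContMDiff (𝓡 m) (𝓡 m).tangent ∞ (fun x => (⟨x, X x⟩ : TangentBundle (𝓡 m) M)))
    (hY : ContMDiff (𝓡 m) (𝓡 m).tangent ∞ (fun x => (⟨x, Y x⟩ : TangentBundle (𝓡 m) M)))
    (g : Metric m M) (h : Metric n N) {φ : M → N} (hφ : ContMDiff (𝓡 m) (𝓡 n) ∞ φ) :
    Continuous
      (tensorInner g (lieDerivative X (pullbackMetric φ h)) (lieDerivative Y g.tensor)) := by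
  refine continuous_iff_continuousAt.2 fun c => ?_
  have hψ := isLocalVariation_chartVariation hX hY c
  set ψ := chartVariation X Y c
  have h1 := contMDiffAt_paramDeriv (0, 1) (contMDiffAt_paramDeriv (1, 0)
    (contMDiffAt_densityFamily g h hφ hψ.smooth))
  have h2 := contMDiffAt_paramDeriv (0, 1) (contMDiffAt_paramDeriv (1, 0)
    (contMDiffAt_movingDensityFamily g h hφ hψ.smooth hψ.smooth
      (injective_mfderiv_of_eventually_eq_id hψ.base)))
  have h3 : ContinuousAt (fun x : M => ((0 : ℝ × ℝ), x)) c :=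
    (Continuous.prodMk_right (0 : ℝ × ℝ)).continuousAt
  have h4 := (ContinuousAt.comp (f := fun x : M => ((0 : ℝ × ℝ), x)) h1.continuousAt h3).sub
    (ContinuousAt.comp (f := fun x : M => ((0 : ℝ × ℝ), x)) h2.continuousAt h3)
  refine h4.congr ?_
  filter_upwards [hψ.eventually] with x hx
  exact mixed_paramDeriv_density_sub hx g h hφ

theorem lieDerivative_eq_zero {X : VField m M} (α : TwoTensor m M) {x : M}
    (hX : ∀ᶠ x' in 𝓝 x, X x' = 0) (u v : TangentSpace (𝓡 m) x)
    (hα : ∀ y u, α y 0 u = 0 ∧ α y u 0 = 0) : lieDerivative X α x u v = 0 := by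
  have hy : extChartAt (𝓡 m) x x ∈ (extChartAt (𝓡 m) x).target := mem_extChartAt_target x
  have hc := (contMDiffAt_chart_symm x hy).continuousAt
  rw [ContinuousAt, extChartAt_to_inv] at hc
  have h1 : coordField X x =ᶠ[𝓝 (extChartAt (𝓡 m) x x)] fun _ => 0 := by
    filter_upwards [hc.eventually hX] with z hz
    rw [coordField, VectorField.mpullback_apply, hz, map_zero]
    rfl
  have h2 : ∀ a : Model m, fderiv ℝ (coordField X x) (extChartAt (𝓡 m) x x) a = 0 := fun a => by
    rw [h1.fderiv_eq]
    simp
  have hz : coordVec x (extChartAt (𝓡 m) x x) 0 = 0 :=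
    map_zero (mfderiv 𝓘(ℝ, Model m) (𝓡 m) (extChartAt (𝓡 m) x).symm (extChartAt (𝓡 m) x x))
  have h3 : ∀ a, coordTensor α x (extChartAt (𝓡 m) x x) 0 a = 0 := fun a =>
    (congrArg (fun w => α _ w _) hz).trans (hα _ _).1
  have h4 : ∀ a, coordTensor α x (extChartAt (𝓡 m) x x) a 0 = 0 := fun a =>
    (congrArg (fun w => α _ _ w) hz).trans (hα _ _).2
  set u' : Model m := mfderiv (𝓡 m) 𝓘(ℝ, Model m) (extChartAt (𝓡 m) x) x u with hu'
  set v' : Model m := mfderiv (𝓡 m) 𝓘(ℝ, Model m) (extChartAt (𝓡 m) x) x v with hv'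
  simp only [lieDerivative]
  rw [← hu', ← hv', h1.eq_of_nhds, h2, h2, h3, h4, map_zero, add_zero, add_zero]

variable [MeasurableSpace M] [BorelSpace M] [T2Space M]

/-- Off the support of `X` the factor `L_X φ^* h` vanishes, so the continuous integrand has compact
support. -/
theorem integrable_tensorInner_lieDerivative {X Y : VField m M}
    (hX : ContMDiff (𝓡 m) (𝓡 m).tangent ∞ (fun x => (⟨x, X x⟩ : TangentBundle (𝓡 m) M)))
    (hXc : IsCompact (closure {x : M | X x ≠ 0}))
    (hY : ContMDiff (𝓡 m) (𝓡 m).tangent ∞ (fun x => (⟨x, Y x⟩ : TangentBundle (𝓡 m) M)))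
    (g : Metric m M) (h : Metric n N) {φ : M → N} (hφ : ContMDiff (𝓡 m) (𝓡 n) ∞ φ) :
    Integrable
      (tensorInner g (lieDerivative X (pullbackMetric φ h)) (lieDerivative Y g.tensor))
      (riemannianVolume g) := by
  refine (continuous_tensorInner_lieDerivative hX hY g h hφ).integrable_of_hasCompactSupport
    (HasCompactSupport.intro hXc fun x hx => ?_)
  have h0 : ∀ᶠ x' in 𝓝 x, X x' = 0 := by
    filter_upwards [isClosed_closure.isOpen_compl.mem_nhds hx] with x' hx'
    by_contra h
    exact hx' (subset_closure h)
  have : tensorMatrix (lieDerivative X (pullbackMetric φ h)) x = 0 := by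
    ext i j
    exact lieDerivative_eq_zero _ h0 _ _ fun y u => by simp [pullbackMetric]
  simp [tensorInner, this]

end Integrability

/-! ### The Hessian: criticality along the shifted curves and the comparison of densities. -/

section Hessian

variable {m n : ℕ}
  {M : Type*} [TopologicalSpace M] [ChartedSpace (Model m) M] [IsManifold (𝓡 m) ∞ M]
  {N : Type*} [TopologicalSpace N] [ChartedSpace (Model n) N] [IsManifold (𝓡 n) ∞ N]

theorem injective_mfderiv_diffeomorph (ψ : M ≃ₘ^∞⟮𝓡 m, 𝓡 m⟯ M) (x : M) :
    Function.Injective (mfderiv (𝓡 m) (𝓡 m) ψ x) := by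
  rw [← ψ.mfderivToContinuousLinearEquiv_coe (by simp)]
  exact (ψ.mfderivToContinuousLinearEquiv (by simp) x).injective

theorem normSqDifferential_eq (g : Metric m M) (h : Metric n N) (φ : M → N) :
    normSqDifferential g h φ =
      relTrace (m := m) (pullbackMetric (fun x : M => x) g) (pullbackMetric φ h) := by
  rw [pullbackMetric_id]
  rfl

theorem relTrace_congr {α α' β β' : TwoTensor m M} {x : M} (hβ : β x = β' x) (hα : α x = α' x) :
    relTrace β α x = relTrace β' α' x := by
  rw [relTrace, relTrace, tensorMatrix_congr hα, tensorMatrix_congr hβ]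

theorem continuous_normSqDifferential (g : Metric m M) (h : Metric n N) {φ : M → N}
    (hφ : ContMDiff (𝓡 m) (𝓡 n) ∞ φ) : Continuous (normSqDifferential g h φ) := by
  have h1 : ContMDiff (𝓘(ℝ, ℝ × ℝ).prod (𝓡 m)) 𝓘(ℝ, ℝ) ∞
      (fun q : (ℝ × ℝ) × M => densityFamily g h φ (fun _ x => x) q.1 q.2) := fun q =>
    contMDiffAt_densityFamily g h hφ (Eventually.of_forall fun q => contMDiffAt_snd)
  rw [normSqDifferential_eq]
  exact continuous_slice h1 0

variable [MeasurableSpace M] [BorelSpace M] [T2Space M]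

/-- `f p` need not have compact support, but `f p - e` does, so integrability is inherited from `e`,
in practice the energy density of `φ`. -/
theorem isCompactVariation_of_eqOn {g : Metric m M} {f : ℝ × ℝ → M → ℝ} {e : M → ℝ}
    (he : Continuous e) (hei : Integrable e (riemannianVolume g))
    (hf : ContMDiff (𝓘(ℝ, ℝ × ℝ).prod (𝓡 m)) 𝓘(ℝ, ℝ) ∞ (fun q : (ℝ × ℝ) × M => f q.1 q.2))
    (hK : ∀ p₀ : ℝ × ℝ, ∃ K : Set M, IsCompact K ∧ ∀ᶠ p in 𝓝 p₀, ∀ x, x ∉ K → f p x = e x) :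
    IsCompactVariation (m := m) f (riemannianVolume g) := by
  refine ⟨hf, fun p₀ => ?_, fun p => ?_⟩
  · obtain ⟨K, hKc, h⟩ := hK p₀
    refine ⟨K, hKc, h.mono fun p hp x hx => ?_⟩
    rw [hp x hx, h.self_of_nhds x hx]
  · obtain ⟨K, hKc, h⟩ := hK p
    have h1 : Integrable (f p - e) (riemannianVolume g) :=
      ((continuous_slice hf p).sub he).integrable_of_hasCompactSupport
        (HasCompactSupport.intro hKc fun x hx => by
          rw [Pi.sub_apply, h.self_of_nhds x hx, sub_self])
    simpa using h1.add hei

theorem isCompactVariation_densityFamily {g : Metric m M} {h : Metric n N} {φ : M → N}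
    (hφ : ContMDiff (𝓡 m) (𝓡 n) ∞ φ) (hE : HasFiniteEnergy g h φ)
    {ψ : ℝ × ℝ → (M ≃ₘ^∞⟮𝓡 m, 𝓡 m⟯ M)} (hψ : IsSmoothFamily g ψ) :
    IsCompactVariation (m := m) (densityFamily g h φ fun p => ψ p) (riemannianVolume g) := by
  refine isCompactVariation_of_eqOn (continuous_normSqDifferential g h hφ) hE
    (fun q => contMDiffAt_densityFamily g h hφ (Eventually.of_forall hψ.smooth)) fun p₀ => ?_
  obtain ⟨K, hK, hp⟩ := hψ.compactSupport p₀
  refine ⟨K, hK, hp.mono fun p hp x hx => ?_⟩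
  rw [normSqDifferential_eq]
  refine relTrace_congr rfl (pullbackMetric_congr h ?_)
  filter_upwards [hK.isClosed.isOpen_compl.mem_nhds hx] with x' hx'
  rw [Function.comp_apply, hp x' hx']

theorem isCompactVariation_movingDensityFamily {g : Metric m M} {h : Metric n N} {φ : M → N}
    (hφ : ContMDiff (𝓡 m) (𝓡 n) ∞ φ) (hE : HasFiniteEnergy g h φ)
    {ψ : ℝ × ℝ → (M ≃ₘ^∞⟮𝓡 m, 𝓡 m⟯ M)} (hψ : IsSmoothFamily g ψ) :
    IsCompactVariation (m := m) (movingDensityFamily g h φ fun p => ψ p) (riemannianVolume g) := by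
  refine isCompactVariation_of_eqOn (continuous_normSqDifferential g h hφ) hE
    (fun q => contMDiffAt_movingDensityFamily g h hφ (Eventually.of_forall hψ.smooth)
      (Eventually.of_forall hψ.smooth) (injective_mfderiv_diffeomorph _ _)) fun p₀ => ?_
  obtain ⟨K, hK, hp⟩ := hψ.compactSupport p₀
  obtain ⟨K', hK', hp'⟩ := hψ.compactSupport (0, p₀.2)
  have hc : Continuous fun p : ℝ × ℝ => ((0 : ℝ), p.2) := by fun_prop
  -- Two supports enter: that of `ψ p` through the pullback of `h`, and that of `ψ (0, p.2)` through
  -- the moving metric.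
  refine ⟨K ∪ K', hK.union hK', ?_⟩
  filter_upwards [hp, (hc.tendsto p₀).eventually hp'] with p hp hp' x hx
  rw [mem_union, not_or] at hx
  rw [normSqDifferential_eq]
  refine relTrace_congr (pullbackMetric_congr g ?_) (pullbackMetric_congr h ?_)
  · filter_upwards [hK'.isClosed.isOpen_compl.mem_nhds hx.2] with x' hx'
    exact hp' x' hx'
  · filter_upwards [hK.isClosed.isOpen_compl.mem_nhds hx.1] with x' hx'
    rw [Function.comp_apply, hp x' hx']

theorem dirichletEnergy_comp_eq (g : Metric m M) (h : Metric n N) (φ : M → N)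
    (ψ : ℝ × ℝ → M → M) (p : ℝ × ℝ) : dirichletEnergy g h (φ ∘ ψ p) =
      (1 / 2 : ℝ) * ∫ x, densityFamily g h φ ψ p x ∂(riemannianVolume g) := by
  rw [dirichletEnergy, normSqDifferential_eq]
  rfl

/-- Substitution of `ψ (0, t)`, which preserves the volume, followed by naturality of the trace. The
inverse disappears from the integrand, which is therefore smooth in both parameters without any
study of inversion. -/
theorem dirichletEnergy_comp_symm_eq {g : Metric m M} (h : Metric n N) {φ : M → N}
    (hφ : ContMDiff (𝓡 m) (𝓡 n) ∞ φ) {ψ : ℝ × ℝ → (M ≃ₘ^∞⟮𝓡 m, 𝓡 m⟯ M)}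
    (hψ : ∀ p, ψ p ∈ SDiff g) (s t : ℝ) :
    dirichletEnergy g h (φ ∘ (ψ (0, t)).symm.trans (ψ (s, t))) = (1 / 2 : ℝ) *
      ∫ x, movingDensityFamily g h φ (fun p => ψ p) (s, t) x ∂(riemannianVolume g) := by
  rw [dirichletEnergy, normSqDifferential_eq]
  set η := (ψ (0, t)).symm.trans (ψ (s, t)) with hη
  congr 1
  rw [← (hψ (0, t)).1.integral_comp (ψ (0, t)).toHomeomorph.measurableEmbedding]
  refine integral_congr_ae (Eventually.of_forall fun x => ?_)
  have h1 := relTrace_comp g h (φ := φ ∘ η) (ρ := fun x : M => x) (χ := ψ (0, t)) (x := x)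
    ((hφ.comp η.contMDiff).mdifferentiable (by simp) _) mdifferentiableAt_id
    ((ψ (0, t)).contMDiff.mdifferentiable (by simp) _) (injective_mfderiv_diffeomorph _ _)
  have h2 : (φ ∘ η) ∘ ψ (0, t) = φ ∘ ψ (s, t) := by
    funext x
    simp [hη]
  rw [h2] at h1
  exact h1.symm

/-- With `t` frozen the inverse is a single diffeomorphism, so no smooth dependence of inverses on
the parameter is required. -/
theorem isSmoothFamily_symm_trans {g : Metric m M} {ψ : ℝ × ℝ → (M ≃ₘ^∞⟮𝓡 m, 𝓡 m⟯ M)}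
    (hψ : IsSmoothFamily g ψ) (t : ℝ) :
    IsSmoothFamily g fun s : ℝ => (ψ (0, t)).symm.trans (ψ (s, t)) := by
  have hsymm : ∀ (θ : M ≃ₘ^∞⟮𝓡 m, 𝓡 m⟯ M) {x : M}, θ x = x → θ.symm x = x := fun θ x hx => by
    conv_lhs => rw [← hx]
    exact θ.symm_apply_apply x
  refine ⟨fun s => ⟨?_, ?_⟩, ?_, fun s₀ => ?_⟩
  · have h1 : MeasurePreserving (ψ (0, t)).symm (riemannianVolume g) (riemannianVolume g) :=
      MeasurePreserving.symm (ψ (0, t)).toHomeomorph.toMeasurableEquiv (hψ.mem (0, t)).1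
    exact (hψ.mem (s, t)).1.comp h1
  · refine ((hψ.mem (0, t)).2.union (hψ.mem (s, t)).2).of_isClosed_subset isClosed_closure ?_
    rw [← closure_union]
    refine closure_mono fun x hx => ?_
    by_contra hcon
    simp only [mem_union, mem_ofPred_eq, not_or, not_not] at hcon
    exact hx (by rw [Diffeomorph.coe_trans, Function.comp_apply, hsymm _ hcon.1, hcon.2])
  · have h1 : ContMDiff (𝓘(ℝ, ℝ).prod (𝓡 m)) (𝓘(ℝ, ℝ × ℝ).prod (𝓡 m)) ∞
        (fun q : ℝ × M => ((q.1, t), (ψ (0, t)).symm q.2)) :=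
      (contMDiff_fst.prodMk_space contMDiff_const).prodMk
        ((ψ (0, t)).symm.contMDiff.comp contMDiff_snd)
    exact hψ.smooth.comp h1
  · obtain ⟨K, hK, hp⟩ := hψ.compactSupport (s₀, t)
    obtain ⟨K', hK', hp'⟩ := hψ.compactSupport (0, t)
    refine ⟨K ∪ K', hK.union hK', ?_⟩
    filter_upwards [((Continuous.prodMk_left t).tendsto s₀).eventually hp] with s hs x hx
    rw [mem_union, not_or] at hx
    rw [Diffeomorph.coe_trans, Function.comp_apply, hsymm _ (hp'.self_of_nhds x hx.2), hs x hx.1]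

/-- Differentiating the energy of a restricted harmonic map with respect to a moving metric along
the first parameter gives zero, for all values of the second parameter. -/
theorem integral_paramDeriv_movingDensityFamily {g : Metric m M} {h : Metric n N} {φ : M → N}
    (hφ : IsRestrictedHarmonic g h φ) {ψ : ℝ × ℝ → (M ≃ₘ^∞⟮𝓡 m, 𝓡 m⟯ M)}
    (hψ : IsSmoothFamily g ψ) (t : ℝ) :
    ∫ x, paramDeriv (1, 0) (movingDensityFamily g h φ fun p => ψ p) (0, t) x
      ∂(riemannianVolume g) = 0 := by
  have h1 := hφ.critical _ (isSmoothFamily_symm_trans hψ t) fun x => by simp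
  have h2 := (isCompactVariation_movingDensityFamily hφ.smooth hφ.finiteEnergy hψ
    ).hasDerivAt_integral (0, t) (1, 0)
  have h3 : (fun s => dirichletEnergy g h (φ ∘ (ψ (0, t)).symm.trans (ψ (s, t)))) = fun s =>
      (1 / 2 : ℝ) * ∫ x, movingDensityFamily g h φ (fun p => ψ p) ((0, t) + s • ((1 : ℝ), (0 : ℝ))) x
        ∂(riemannianVolume g) := by
    funext s
    rw [dirichletEnergy_comp_symm_eq h hφ.smooth hψ.mem]
    simp
  rw [h3] at h1
  have := (h2.const_mul (1 / 2 : ℝ)).unique h1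
  linarith

theorem IsVariationTangentTo.isLocalVariation {g : Metric m M} {X Y : VField m M}
    {ψ : ℝ × ℝ → (M ≃ₘ^∞⟮𝓡 m, 𝓡 m⟯ M)} (hψ : IsVariationTangentTo g X Y ψ) (x : M) :
    IsLocalVariation X Y (fun p => ψ p) x :=
  ⟨Eventually.of_forall hψ.family.smooth, Eventually.of_forall hψ.base,
    Eventually.of_forall hψ.tangent_left, Eventually.of_forall hψ.tangent_right⟩

theorem hasMixedDerivAtZero_dirichletEnergy {g : Metric m M} {h : Metric n N} {φ : M → N}
    (hφ : IsRestrictedHarmonic g h φ) {X Y : VField m M} {ψ : ℝ × ℝ → (M ≃ₘ^∞⟮𝓡 m, 𝓡 m⟯ M)}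
    (hψ : IsVariationTangentTo g X Y ψ) :
    HasMixedDerivAtZero (fun p => dirichletEnergy g h (φ ∘ ψ p)) ((1 / 2 : ℝ) * tensorL2Inner g
      (lieDerivative X (pullbackMetric φ h)) (lieDerivative Y g.tensor)) := by
  set f₁ := densityFamily g h φ fun p => ψ p with hf₁
  set f₂ := movingDensityFamily g h φ fun p => ψ p with hf₂
  have h₁ := isCompactVariation_densityFamily hφ.smooth hφ.finiteEnergy hψ.family
  have h₂ := isCompactVariation_movingDensityFamily hφ.smooth hφ.finiteEnergy hψ.family
  rw [← hf₁] at h₁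
  rw [← hf₂] at h₂
  refine ⟨fun s => (1 / 2 : ℝ) * ∫ x, paramDeriv (0, 1) f₁ (s, 0) x ∂(riemannianVolume g),
    Eventually.of_forall fun s => ?_, ?_⟩
  · have h3 := (h₁.hasDerivAt_integral (s, 0) (0, 1)).const_mul (1 / 2 : ℝ)
    refine h3.congr_of_eventuallyEq (Eventually.of_forall fun t => ?_)
    simp only [Prod.smul_mk, smul_eq_mul, mul_zero, mul_one, Prod.mk_add_mk, add_zero, zero_add]
    exact dirichletEnergy_comp_eq g h φ (fun p => ψ p) (s, t)
  · have h3 := ((h₁.paramDeriv (0, 1)).hasDerivAt_integral (0, 0) (1, 0)).const_mul (1 / 2 : ℝ)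
    refine (h3.congr_of_eventuallyEq (Eventually.of_forall fun s => ?_)).congr_deriv ?_
    · simp
    -- The `s`-derivative of the moving energy vanishes at `s = 0` for all `t`, so it may be
    -- differentiated in `t`.
    · have h4 : ∫ x, paramDeriv (0, 1) (paramDeriv (1, 0) f₂) 0 x ∂(riemannianVolume g) = 0 := by
        have h5 := (h₂.paramDeriv (1, 0)).hasDerivAt_integral (0, 0) (0, 1)
        have h6 : (fun t : ℝ => ∫ x, paramDeriv (1, 0) f₂ ((0, 0) + t • ((0 : ℝ), (1 : ℝ))) x
            ∂(riemannianVolume g)) = fun _ => 0 := by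
          funext t
          simpa using integral_paramDeriv_movingDensityFamily hφ hψ.family t
        rw [h6] at h5
        exact h5.unique (hasDerivAt_const _ _)
      congr 1
      -- The mixed derivative takes `∂_t` first, whereas criticality controls `∂_s` first; symmetry
      -- of second derivatives reconciles the two orders.
      have h7 : ∀ x, paramDeriv (1, 0) (paramDeriv (0, 1) f₁) (0, 0) x =
          paramDeriv (0, 1) (paramDeriv (1, 0) f₁) 0 x := fun x =>
        paramDeriv_comm _ _ (contDiffAt_slice (h₁.smooth _))
      calc ∫ x, paramDeriv (1, 0) (paramDeriv (0, 1) f₁) (0, 0) x ∂(riemannianVolume g)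
          = ∫ x, paramDeriv (0, 1) (paramDeriv (1, 0) f₁) 0 x ∂(riemannianVolume g) -
            ∫ x, paramDeriv (0, 1) (paramDeriv (1, 0) f₂) 0 x ∂(riemannianVolume g) := by
            rw [h4, sub_zero]
            simp only [h7]
        _ = ∫ x, (paramDeriv (0, 1) (paramDeriv (1, 0) f₁) 0 x -
            paramDeriv (0, 1) (paramDeriv (1, 0) f₂) 0 x) ∂(riemannianVolume g) :=
            (integral_sub (((h₁.paramDeriv (1, 0)).paramDeriv (0, 1)).integrable 0)
              (((h₂.paramDeriv (1, 0)).paramDeriv (0, 1)).integrable 0)).symm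
        _ = tensorL2Inner g (lieDerivative X (pullbackMetric φ h)) (lieDerivative Y g.tensor) :=
            integral_congr_ae (Eventually.of_forall fun x =>
              mixed_paramDeriv_density_sub (hψ.isLocalVariation x) g h hφ.smooth)

end Hessian

end RestrictedHarmonic

end

theorem theorem3p2 {m n : ℕ}
    {M : Type*} [TopologicalSpace M] [T2Space M] [SecondCountableTopology M]
    [ChartedSpace (EuclideanSpace ℝ (Fin m)) M] [IsManifold (𝓡 m) ∞ M]
    [MeasurableSpace M] [BorelSpace M]
    {N : Type*} [TopologicalSpace N] [T2Space N] [SecondCountableTopology N]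
    [ChartedSpace (EuclideanSpace ℝ (Fin n)) N] [IsManifold (𝓡 n) ∞ N]
    (g : RestrictedHarmonic.Metric m M) (h : RestrictedHarmonic.Metric n N)
    (φ : M → N) (hφ : RestrictedHarmonic.IsRestrictedHarmonic g h φ) :
    (∀ X Y : RestrictedHarmonic.VField m M,
      RestrictedHarmonic.IsDivFreeCompactField g X →
      RestrictedHarmonic.IsDivFreeCompactField g Y →
      Integrable
        (RestrictedHarmonic.tensorInner g
          (RestrictedHarmonic.lieDerivative X (RestrictedHarmonic.pullbackMetric φ h))
          (RestrictedHarmonic.lieDerivative Y g.tensor))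
        (RestrictedHarmonic.riemannianVolume g)) ∧
    RestrictedHarmonic.IsHessian g h φ (fun X Y =>
      (1 / 2 : ℝ) * RestrictedHarmonic.tensorL2Inner g
        (RestrictedHarmonic.lieDerivative X (RestrictedHarmonic.pullbackMetric φ h))
        (RestrictedHarmonic.lieDerivative Y g.tensor)) := by
  exact ⟨fun X Y hX hY => RestrictedHarmonic.integrable_tensorInner_lieDerivative hX.smooth
      hX.compactSupport hY.smooth g h hφ.smooth,
    fun X Y _ _ ψ hψ => RestrictedHarmonic.hasMixedDerivAtZero_dirichletEnergy hφ hψ⟩
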